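/- **Conventions.** Let $p\le q$, $n=p+q$, and let $\nu_{p,q}$ be the scalar product on $\mathbb R^n$ with $(p,q-p,p)$-block matrix $\left[\begin{smallmatrix}0&0&I_p\\0&I_{q-p}&0\\I_p&0&0\end{smallmatrix}\right]$, which has $p$ negative and $q$ positive squares. Let $\mathfrak{so}(p+1,q+1)$ be the Lie algebra of matrices $A\in\mathfrak{gl}(n+2,\mathbb R)$ with $A^t\mathbf g+\mathbf gA=0$, where $\mathbf g=\left[\begin{smallmatrix}0&0&1\\0&\nu_{p,q}&0\\1&0&0\end{smallmatrix}\right]$ in $(1,n,1)$-blocks, and write $\{\ ,\ \}$ for its bracket. It decomposes as $\mathbb R^n\oplus\mathfrak{co}(p,q)\oplus\mathbb R^{n*}$, where $\mathbb R^n$ is given by the middle part of the first column (the part below the block diagonal), $\mathfrak{co}(p,q)$ by the block diagonal, and $\mathbb R^{n*}$ by the middle part of the first row (the part above the block diagonal). Put $\mathfrak p=\mathfrak{co}(p,q)\oplus\mathbb R^{n*}$, so that $\mathfrak{so}(p+1,q+1)/\mathfrak p\cong\mathbb R^n$. **Proposition.** Let $M$ be a smooth manifold of dimension $n=p+q$ with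 a conformal class $[g]$ of smooth pseudo-Riemannian metrics of signature $(p,q)$ ($p\le q$), and let $K$ be a (finite-dimensional real) Lie group acting smoothly and transitively on $M$ by conformal symmetries of $[g]$. Let $o\in M$, let $H\subset K$ be the stabilizer of $o$, and let $\mathfrak k,\mathfrak h$ be the Lie algebras of $K,H$, so that $T_oM=\mathfrak k/\mathfrak h$ through the differential of the orbit map $k\mapsto k\cdot o$. Let $\alpha_{-1}:T_oM=\mathfrak k/\mathfrak h\to\mathbb R^n$ be a linear isomorphism such that $\alpha_{-1}^*\nu_{p,q}\in[g]_o$, i.e. $\alpha_{-1}^*\nu_{p,q}=g'_o$ for some $g'\in[g]$. Then there is a linear map $\alpha:\mathfrak k\to\mathfrak{so}(p+1,q+1)$ such that 1. $\{\alpha(Y_1),\alpha(Y_h)\}-\alpha([Y_1,Y_h])=0$ for all $Y_1\in\mathfrak k$, $Y_h\in\mathfrak h$; 2. $\alpha(\mathfrak h)\subset\mathfrak p$, the induced map $\mathfrak k/\mathfrak h\to\mathfrak{so}(p+1,q+1)/\mathfrak p$ is surjective, and, under $\mathfrak{so}(p+1,q+1)/\mathfrak p\cong\mathbb R^n$, this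 induced map is $\alpha_{-1}$; 3. the curvature $$\kappa(\alpha(Y_1)+\mathfrak p,\alpha(Y_2)+\mathfrak p):=\{\alpha(Y_1),\alpha(Y_2)\}-\alpha([Y_1,Y_2])$$ is a well-defined alternating bilinear map on $\mathfrak{so}(p+1,q+1)/\mathfrak p$ with values in $\mathfrak{so}(p+1,q+1)$, and it satisfies the normalization condition $$\sum_i\{Z_i,\kappa(\alpha(Y)+\mathfrak p,\alpha(X_i)+\mathfrak p)\}=0\qquad\text{(Nor)}$$ for all $Y\in\mathfrak k$, where $X_i\in\mathfrak k$ are any representatives of a basis $\alpha_{-1}(X_i)$ of $\mathbb R^n$ and $Z_i\in\mathbb R^{n*}\subset\mathfrak{so}(p+1,q+1)$ form the dual basis. -/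

import Mathlib

open Matrix Manifold Bundle
open scoped ContDiff

attribute [local instance] LieRing.ofAssociativeRing

noncomputable section

/-! ### The Lie algebra `𝔰𝔬(p+1,q+1)` in block form -/

/-- Index set of `ℝⁿ`, `n = p + q`, with blocks of sizes `(p, q - p, p)`; used for `p ≤ q`. -/
abbrev MidIdx (p q : ℕ) : Type := Fin p ⊕ (Fin (q - p) ⊕ Fin p)

/-- Index set of `𝕋 = ℝⁿ⁺²`, with blocks of sizes `(1, p, q - p, p, 1)`. -/
abbrev TractorIdx (p q : ℕ) : Type := Unit ⊕ (MidIdx p q ⊕ Unit)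

/-- The matrix `ν_{p,q}` of the scalar product of signature `(p,q)` on `ℝⁿ`
(`p` minus signs, `q` plus signs), with identity blocks on the block antidiagonal. -/
def nuMatrix (p q : ℕ) : Matrix (MidIdx p q) (MidIdx p q) ℝ :=
  fromBlocks 0 (fromCols 0 1) (fromRows 0 1) (fromBlocks 1 0 0 0)

/-- The scalar product `ν_{p,q}` on `ℝⁿ`. -/
def nuForm (p q : ℕ) (x y : MidIdx p q → ℝ) : ℝ := x ⬝ᵥ (nuMatrix p q *ᵥ y)

/-- The matrix `𝐠` of the scalar product of signature `(p+1,q+1)` on `𝕋 = ℝⁿ⁺²`. -/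
def tractorMetric (p q : ℕ) : Matrix (TractorIdx p q) (TractorIdx p q) ℝ :=
  fromBlocks 0 (fromCols 0 1) (fromRows 0 1) (fromBlocks (nuMatrix p q) 0 0 0)

/-- `𝔰𝔬(p+1,q+1)`: the matrices `A` that preserve `𝐠`, that is `Aᵀ 𝐠 + 𝐠 A = 0`, with the
commutator as Lie bracket. -/
abbrev soAlg (p q : ℕ) : LieSubalgebra ℝ (Matrix (TractorIdx p q) (TractorIdx p q) ℝ) :=
  skewAdjointMatricesLieSubalgebra (tractorMetric p q)

/-- The `ℝⁿ`-part, that is the `(u, v, w)`-part (first column), of an element of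
`𝔰𝔬(p+1,q+1)`. -/
def vectorPart (p q : ℕ) : soAlg p q →ₗ[ℝ] (MidIdx p q → ℝ) where
  toFun A i := A.1 (Sum.inr (Sum.inl i)) (Sum.inl ())
  map_add' _ _ := rfl
  map_smul' _ _ := rfl

/-- The Poincaré (parabolic) subalgebra `𝔭 = 𝔠𝔬(p,q) ⊕ ℝⁿ*` of `𝔰𝔬(p+1,q+1)`, as a subspace:
the block upper triangular elements, those with vanishing `ℝⁿ`-part. The projection along `𝔭`
onto `ℝⁿ` is `vectorPart`. -/
def parabolic (p q : ℕ) : Submodule ℝ (soAlg p q) := LinearMap.ker (vectorPart p q)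

/-- The nilpotent matrix with first row `(0, φ, 0)` and last column `(0, -ν φᵗ, 0)`: the
`(b, c, d)`-part of the block form. -/
def dualMatrix (p q : ℕ) (φ : Module.Dual ℝ (MidIdx p q → ℝ)) :
    Matrix (TractorIdx p q) (TractorIdx p q) ℝ :=
  fromBlocks 0 (fromCols (of fun _ i => φ (Pi.single i 1)) 0) 0
    (fromBlocks 0 (of fun i _ => -(nuMatrix p q *ᵥ fun j => φ (Pi.single j 1)) i) 0 0)

theorem nuMatrix_transpose (p q : ℕ) : (nuMatrix p q)ᵀ = nuMatrix p q := by
  ext i j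
  rcases i with i | i | i <;> rcases j with j | j | j <;>
    simp [nuMatrix, fromBlocks, one_apply, eq_comm]

theorem nuMatrix_mul_self (p q : ℕ) : nuMatrix p q * nuMatrix p q = 1 := by
  ext i j
  rcases i with i | i | i <;> rcases j with j | j | j <;>
    simp [nuMatrix, fromBlocks, mul_apply, one_apply]

theorem dualMatrix_mem (p q : ℕ) (φ : Module.Dual ℝ (MidIdx p q → ℝ)) :
    dualMatrix p q φ ∈ soAlg p q := by
  have hν : ∀ r : MidIdx p q → ℝ, nuMatrix p q *ᵥ (nuMatrix p q *ᵥ r) = r := fun r => by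
    rw [mulVec_mulVec, nuMatrix_mul_self, one_mulVec]
  have hs : ∀ i j, nuMatrix p q i j = nuMatrix p q j i := fun i j =>
    congrFun (congrFun (nuMatrix_transpose p q) j) i
  rw [mem_skewAdjointMatricesLieSubalgebra, mem_skewAdjointMatricesSubmodule]
  change (dualMatrix p q φ)ᵀ * tractorMetric p q = tractorMetric p q * (-dualMatrix p q φ)
  have hr := hν fun j => φ (Pi.single j 1)
  ext i j
  rcases i with i | i | i <;> rcases j with j | j | j <;>
    simp [tractorMetric, dualMatrix, mul_apply, Fintype.sum_sum_type (α₁ := Unit),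
      Fintype.sum_sum_type (α₁ := MidIdx p q), -mulVec_mulVec]
  · have := congrFun hr i
    rw [mulVec, dotProduct] at this
    simpa using this.symm
  · have := congrFun hr j
    rw [mulVec, dotProduct, Fintype.sum_sum_type, Fintype.sum_sum_type] at this
    simp only [hs j, mul_comm (nuMatrix p q _ j)] at this
    linarith

/-- The inclusion of `ℝⁿ*` into `𝔰𝔬(p+1,q+1)` as the `(b, c, d)`-part. The evaluation pairing of
`ℝⁿ*` and `ℝⁿ` is, up to the factor `2n`, the one given by the Killing form of
`𝔰𝔬(p+1,q+1)`. -/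
def dualEmb (p q : ℕ) (φ : Module.Dual ℝ (MidIdx p q → ℝ)) : soAlg p q :=
  ⟨dualMatrix p q φ, dualMatrix_mem p q φ⟩

/-! ### Conformal structures -/

/-- A smooth pseudo-Riemannian metric of signature `(p,q)` on a smooth manifold `M` of dimension
`p + q`. -/
structure PseudoRiemannianMetric (p q : ℕ) (M : Type*) [TopologicalSpace M]
    [ChartedSpace (EuclideanSpace ℝ (Fin (p + q))) M]
    [IsManifold 𝓘(ℝ, EuclideanSpace ℝ (Fin (p + q))) ∞ M] where
  /-- The scalar product on the tangent spaces. -/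
  inner (x : M) : TangentSpace 𝓘(ℝ, EuclideanSpace ℝ (Fin (p + q))) x →L[ℝ]
    TangentSpace 𝓘(ℝ, EuclideanSpace ℝ (Fin (p + q))) x →L[ℝ] ℝ
  symm (x : M) (v w : TangentSpace 𝓘(ℝ, EuclideanSpace ℝ (Fin (p + q))) x) :
    inner x v w = inner x w v
  /-- Signature `(p,q)`: each tangent space has an orthogonal basis of `p` vectors of square `-1`
  and `q` vectors of square `1`. -/
  signature (x : M) :
    ∃ b : Module.Basis (Fin p ⊕ Fin q) ℝ (TangentSpace 𝓘(ℝ, EuclideanSpace ℝ (Fin (p + q))) x),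
      ∀ i j, inner x (b i) (b j) =
        if i = j then Sum.elim (fun _ => (-1 : ℝ)) (fun _ => 1) i else 0
  contMDiff : ContMDiff 𝓘(ℝ, EuclideanSpace ℝ (Fin (p + q)))
    (𝓘(ℝ, EuclideanSpace ℝ (Fin (p + q))).prod 𝓘(ℝ, EuclideanSpace ℝ (Fin (p + q)) →L[ℝ]
      EuclideanSpace ℝ (Fin (p + q)) →L[ℝ] ℝ)) ∞
    (fun x => TotalSpace.mk' (EuclideanSpace ℝ (Fin (p + q)) →L[ℝ]
      EuclideanSpace ℝ (Fin (p + q)) →L[ℝ] ℝ)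
      (E := fun x : M => TangentSpace 𝓘(ℝ, EuclideanSpace ℝ (Fin (p + q))) x →L[ℝ]
        TangentSpace 𝓘(ℝ, EuclideanSpace ℝ (Fin (p + q))) x →L[ℝ] ℝ) x (inner x))

section Conformal

variable {p q : ℕ} {M : Type*} [TopologicalSpace M]
  [ChartedSpace (EuclideanSpace ℝ (Fin (p + q))) M]
  [IsManifold 𝓘(ℝ, EuclideanSpace ℝ (Fin (p + q))) ∞ M]

/-- The conformal class `[g]`: all metrics `f g` with `f` a positive smooth function. -/
def conformalClass (g : PseudoRiemannianMetric p q M) : Set (PseudoRiemannianMetric p q M) :=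
  {g' | ∃ f : M → ℝ, ContMDiff 𝓘(ℝ, EuclideanSpace ℝ (Fin (p + q))) 𝓘(ℝ) ∞ f ∧
    (∀ x, 0 < f x) ∧ ∀ x v w, g'.inner x v w = f x * g.inner x v w}

/-- A map `φ : M → M` preserves the conformal class `[g]`: the pullback `φ^* g` lies in `[g]`. -/
def PreservesConformalClass (g : PseudoRiemannianMetric p q M) (φ : M → M) : Prop :=
  ∃ g' ∈ conformalClass g, ∀ x v w, g'.inner x v w =
    g.inner (φ x)
      (mfderiv 𝓘(ℝ, EuclideanSpace ℝ (Fin (p + q))) 𝓘(ℝ, EuclideanSpace ℝ (Fin (p + q))) φ x v)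
      (mfderiv 𝓘(ℝ, EuclideanSpace ℝ (Fin (p + q))) 𝓘(ℝ, EuclideanSpace ℝ (Fin (p + q))) φ x w)

end Conformal

/-- `(M, [g])` is a `K`-homogeneous conformal geometry: the Lie group `K` acts smoothly and
transitively on `M` by conformal symmetries of `[g]`. -/
structure IsHomogeneousConformal {p q : ℕ} {M : Type*} [TopologicalSpace M]
    [ChartedSpace (EuclideanSpace ℝ (Fin (p + q))) M]
    [IsManifold 𝓘(ℝ, EuclideanSpace ℝ (Fin (p + q))) ∞ M] (EK : Type*) [NormedAddCommGroup EK]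
    [NormedSpace ℝ EK] (K : Type*) [TopologicalSpace K] [ChartedSpace EK K] [Group K]
    [MulAction K M] (g : PseudoRiemannianMetric p q M) : Prop where
  smooth_action : ContMDiff (𝓘(ℝ, EK).prod 𝓘(ℝ, EuclideanSpace ℝ (Fin (p + q))))
    𝓘(ℝ, EuclideanSpace ℝ (Fin (p + q))) ∞ (fun x : K × M => x.1 • x.2)
  transitive : MulAction.IsPretransitive K M
  conformal (k : K) : PreservesConformalClass g (fun x => k • x)

/-- The Lie algebra of a closed subgroup `H` of a Lie group `K`, as a subspace of the Lie algebra
of `K`: the tangent vectors at `1` of curves in `K` that stay in `H`. (For closed `H` these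
vectors form a subspace, so the span adds nothing.) -/
def subgroupLieAlgebra {EK : Type*} [NormedAddCommGroup EK] [NormedSpace ℝ EK] {K : Type*}
    [TopologicalSpace K] [ChartedSpace EK K] [Group K] (H : Subgroup K) :
    Submodule ℝ (GroupLieAlgebra 𝓘(ℝ, EK) K) :=
  Submodule.span ℝ {Y | ∃ γ : ℝ → K, γ 0 = 1 ∧ (∀ t, γ t ∈ H) ∧
    MDifferentiableAt 𝓘(ℝ) 𝓘(ℝ, EK) γ 0 ∧ mfderiv 𝓘(ℝ) 𝓘(ℝ, EK) γ 0 (1 : ℝ) = Y}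

/-- The differential at `1` of the orbit map `k ↦ k • o`, as a map `𝔨 → T_o M`. Its kernel is the
Lie algebra `𝔥` of the stabilizer of `o`, and it induces the identification of `𝔨 ⧸ 𝔥` with
`T_o M`. -/
def orbitDiff {p q : ℕ} {M : Type*} [TopologicalSpace M]
    [ChartedSpace (EuclideanSpace ℝ (Fin (p + q))) M] {EK : Type*} [NormedAddCommGroup EK]
    [NormedSpace ℝ EK] {K : Type*} [TopologicalSpace K] [ChartedSpace EK K] [Group K]
    [MulAction K M] (o : M) (Y : GroupLieAlgebra 𝓘(ℝ, EK) K) :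
    TangentSpace 𝓘(ℝ, EuclideanSpace ℝ (Fin (p + q))) o :=
  mfderiv 𝓘(ℝ, EK) 𝓘(ℝ, EuclideanSpace ℝ (Fin (p + q))) (fun k : K => k • o) 1 Y

end

/-! An element of `𝔰𝔬(p+1,q+1)` has components `(x, a, S, w)`: a vector, a scalar, a `ν`-skew
endomorphism and a covector, which `ν` turns into a vector. The map `α` therefore amounts to linear
maps `(θ, a, S, w)` on `𝔨`, where `θ` is `α_{-1}` after the quotient map. The task is to choose `a`,
`S`, `w` so that the curvature vanishes when one argument lies in `𝔥 = ker θ` and its Ricci-type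
contraction vanishes.

The geometry enters once (`exists_inner_orbitDiff_lie`): `ad h` for `h ∈ 𝔥` induces an
infinitesimally conformal map of `𝔨/𝔥`. From then on the argument is pure algebra. Splitting off the
conformal factor and applying the Koszul formula to the bracket on a complement of `𝔥` gives `a` and
`S` without torsion (`exists_torsionFree`).

For `n ≥ 3`, the first prolongation of `𝔠𝔬(p,q)` consists of covectors, and this forces `w` on `𝔥`
to be dual to `a[h,·]`. That choice kills the `𝔠𝔬`-part of the curvature along `𝔥`
(`curv_eq_zero_of_ker`). On the complement `w` can be changed by an endomorphism `P`, and the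
normalization is a linear system for `P` that is injective, hence bijective
(`exists_trace_ricOp_eq`). The `ℝⁿ*`-part of the curvature along `𝔥` is then the solution of the
corresponding homogeneous system, by the Bianchi identity, so it vanishes (`curvW_eq_zero_of_ker`).

For `n ≤ 2` this system is not available, and a flat `α`, that is, a homomorphism, is constructed
instead. Lie's theorem on the line (`exists_sl_two_components`) maps a finite-dimensional Lie
algebra with a subalgebra of codimension at most one to `𝔰𝔩₂`. It is used over `ℝ` for `n = 1`, once
for each null coordinate in signature `(1,1)`, and over `ℂ` in signature `(0,2)`. -/

/-! ### The Lie algebra `𝔰𝔬(p+1,q+1)` in components. -/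

/-- The scalar product `ν_{p,q}` as a bilinear form. -/
noncomputable def nuBil (p q : ℕ) : LinearMap.BilinForm ℝ (MidIdx p q → ℝ) :=
  Matrix.toBilin' (nuMatrix p q)

theorem nuBil_apply (p q : ℕ) (x y : MidIdx p q → ℝ) :
    nuBil p q x y = x ⬝ᵥ (nuMatrix p q *ᵥ y) :=
  Matrix.toBilin'_apply' _ _ _

theorem nuBil_comm (p q : ℕ) (x y : MidIdx p q → ℝ) : nuBil p q x y = nuBil p q y x := by
  rw [nuBil_apply, nuBil_apply, dotProduct_mulVec, ← mulVec_transpose, nuMatrix_transpose,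
    dotProduct_comm]

theorem nuBil_nondegenerate (p q : ℕ) : (nuBil p q).Nondegenerate := by
  have h : IsUnit (nuMatrix p q).det := by
    have := congrArg det (nuMatrix_mul_self p q)
    rw [det_mul, det_one] at this
    exact IsUnit.of_mul_eq_one _ this
  rw [nuBil]
  exact LinearMap.BilinForm.nondegenerate_toBilin'_of_det_ne_zero' _ h.ne_zero

/-- The element of `𝔰𝔬(p+1,q+1)` with first column `(a, x, 0)`, first row `(a, (ν w)ᵗ, 0)` and
middle block `S`, as a matrix. -/
noncomputable def soMatrix (p q : ℕ) (x : MidIdx p q → ℝ) (a : ℝ)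
    (S : (MidIdx p q → ℝ) →ₗ[ℝ] MidIdx p q → ℝ) (w : MidIdx p q → ℝ) :
    Matrix (TractorIdx p q) (TractorIdx p q) ℝ :=
  fromBlocks (of fun _ _ => a) (fromCols (of fun _ i => (nuMatrix p q *ᵥ w) i) 0)
    (fromRows (of fun i _ => x i) 0)
    (fromBlocks (LinearMap.toMatrix' S) (of fun i _ => -w i)
      (of fun _ i => -(nuMatrix p q *ᵥ x) i) (of fun _ _ => -a))

variable {p q : ℕ}

theorem nuMatrix_mulVec_mulVec (x : MidIdx p q → ℝ) :
    nuMatrix p q *ᵥ (nuMatrix p q *ᵥ x) = x := by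
  rw [mulVec_mulVec, nuMatrix_mul_self, one_mulVec]

theorem nuMatrix_apply_comm (i j : MidIdx p q) : nuMatrix p q i j = nuMatrix p q j i :=
  congrFun (congrFun (nuMatrix_transpose p q) j) i

theorem toMatrix'_transpose_mul_nuMatrix {S : (MidIdx p q → ℝ) →ₗ[ℝ] MidIdx p q → ℝ}
    (hS : ∀ u v, nuBil p q (S u) v = -nuBil p q u (S v)) :
    (LinearMap.toMatrix' S)ᵀ * nuMatrix p q = -(nuMatrix p q * LinearMap.toMatrix' S) := by
  ext i j
  have h := hS (Pi.single i 1) (Pi.single j 1)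
  rw [nuBil_apply, nuBil_apply, dotProduct, dotProduct] at h
  simpa [mul_apply, LinearMap.toMatrix'_apply, mulVec, dotProduct, Pi.single_apply] using h

theorem soMatrix_mem (x : MidIdx p q → ℝ) (a : ℝ)
    {S : (MidIdx p q → ℝ) →ₗ[ℝ] MidIdx p q → ℝ}
    (hS : ∀ u v, nuBil p q (S u) v = -nuBil p q u (S v)) (w : MidIdx p q → ℝ) :
    soMatrix p q x a S w ∈ soAlg p q := by
  rw [mem_skewAdjointMatricesLieSubalgebra, mem_skewAdjointMatricesSubmodule]
  change (soMatrix p q x a S w)ᵀ * tractorMetric p q = tractorMetric p q * (-soMatrix p q x a S w)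
  have hM := toMatrix'_transpose_mul_nuMatrix hS
  have e1 : ∀ (x : MidIdx p q → ℝ) i, ∑ j, x j * nuMatrix p q j i = (nuMatrix p q *ᵥ x) i := by
    intro x i
    rw [mulVec, dotProduct]
    exact Finset.sum_congr rfl fun j _ => by rw [nuMatrix_apply_comm, mul_comm]
  have e2 : ∀ (x : MidIdx p q → ℝ) i, ∑ j, nuMatrix p q i j * x j = (nuMatrix p q *ᵥ x) i :=
    fun x i => rfl
  rw [← Matrix.ext_iff]
  rintro (i | i | i) (j | j | j) <;>
    simp [tractorMetric, soMatrix, mul_apply, Fintype.sum_sum_type (α₁ := Unit),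
      Fintype.sum_sum_type (α₁ := MidIdx p q), e1, e2, one_apply, -LinearMap.toMatrix'_apply,
      -mulVec_mulVec]
  · rw [← e1]
    have h := congrFun (congrFun hM i) j
    rwa [mul_apply, Matrix.neg_apply, mul_apply] at h

theorem nuBil_single (w : MidIdx p q → ℝ) (j : MidIdx p q) :
    nuBil p q w (Pi.single j 1) = (nuMatrix p q *ᵥ w) j := by
  rw [nuBil_comm, nuBil_apply, single_dotProduct, one_mul]

theorem nuBil_toMatrix'_col {S : (MidIdx p q → ℝ) →ₗ[ℝ] MidIdx p q → ℝ}
    (hS : ∀ u v, nuBil p q (S u) v = -nuBil p q u (S v)) (w : MidIdx p q → ℝ) (j : MidIdx p q) :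
    (nuBil p q w fun i => LinearMap.toMatrix' S i j) = -(nuMatrix p q *ᵥ S w) j := by
  rw [← nuBil_single, hS, neg_neg]
  congr 1

theorem soMatrix_lie (x x' : MidIdx p q → ℝ) (a a' : ℝ)
    {S S' : (MidIdx p q → ℝ) →ₗ[ℝ] MidIdx p q → ℝ}
    (hS : ∀ u v, nuBil p q (S u) v = -nuBil p q u (S v))
    (hS' : ∀ u v, nuBil p q (S' u) v = -nuBil p q u (S' v)) (w w' : MidIdx p q → ℝ) :
    ⁅soMatrix p q x a S w, soMatrix p q x' a' S' w'⁆ =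
      soMatrix p q ((S x' - a • x') - (S' x - a' • x)) (nuBil p q w x' - nuBil p q w' x)
        (S ∘ₗ S' - S' ∘ₗ S + (nuBil p q w').smulRight x - (nuBil p q w).smulRight x'
          + (nuBil p q x').smulRight w - (nuBil p q x).smulRight w')
        ((S w' + a • w') - (S' w + a' • w)) := by
  have e0 : ∀ x w : MidIdx p q → ℝ, ∑ j, (nuMatrix p q *ᵥ w) j * x j = nuBil p q w x := by
    intro x w
    rw [nuBil_comm, nuBil_apply, dotProduct]
    exact Finset.sum_congr rfl fun i _ => mul_comm _ _
  have e1 : ∀ (S : (MidIdx p q → ℝ) →ₗ[ℝ] MidIdx p q → ℝ) (x : MidIdx p q → ℝ) i,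
      ∑ j, LinearMap.toMatrix' S i j * x j = S x i := by
    intro S x i
    have := congrFun (LinearMap.toMatrix'_mulVec S x) i
    rwa [mulVec, dotProduct] at this
  have e2 := nuBil_toMatrix'_col hS
  have e2' := nuBil_toMatrix'_col hS'
  have c1 := nuBil_comm p q w x'
  have c2 := nuBil_comm p q w' x
  rw [Ring.lie_def, ← Matrix.ext_iff]
  rintro (i | i | i) (j | j | j) <;>
    simp [soMatrix, mul_apply, Fintype.sum_sum_type (α₁ := Unit),
      Fintype.sum_sum_type (α₁ := MidIdx p q), e0, e1, e2, e2', mulVec_sub, mulVec_add,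
      mulVec_smul, LinearMap.toMatrix'_comp, map_sub, map_add, -LinearMap.toMatrix'_apply]
  · ring
  · ring
  · rw [nuBil_comm]
    ring
  · ring
  · have e3 : ∀ S : (MidIdx p q → ℝ) →ₗ[ℝ] MidIdx p q → ℝ,
        (fun k => LinearMap.toMatrix' S k j) = S (Pi.single j 1) := fun S => by
      ext k
      rw [LinearMap.toMatrix'_apply]
    have e4 : ∀ y z : MidIdx p q → ℝ, LinearMap.toMatrix' ((nuBil p q y).smulRight z) i j =
        (nuMatrix p q *ᵥ y) j * z i := fun y z => by
      rw [LinearMap.toMatrix'_apply, LinearMap.smulRight_apply, nuBil_single, Pi.smul_apply,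
        smul_eq_mul]
    rw [e3, e3, ← LinearMap.comp_apply, ← LinearMap.comp_apply, e4, e4, e4, e4]
    ring
  · ring
  · rw [nuBil_comm]
    ring
  · ring
  · linarith

variable {p q : ℕ}

/-- The element of `𝔰𝔬(p+1,q+1)` with the matrix `soMatrix p q x a S w`. -/
noncomputable def soElt (x : MidIdx p q → ℝ) (a : ℝ)
    (S : (MidIdx p q → ℝ) →ₗ[ℝ] MidIdx p q → ℝ)
    (hS : ∀ u v, nuBil p q (S u) v = -nuBil p q u (S v)) (w : MidIdx p q → ℝ) : soAlg p q :=
  ⟨soMatrix p q x a S w, soMatrix_mem x a hS w⟩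

theorem soMatrix_add (x x' : MidIdx p q → ℝ) (a a' : ℝ)
    (S S' : (MidIdx p q → ℝ) →ₗ[ℝ] MidIdx p q → ℝ) (w w' : MidIdx p q → ℝ) :
    soMatrix p q (x + x') (a + a') (S + S') (w + w') =
      soMatrix p q x a S w + soMatrix p q x' a' S' w' := by
  rw [← Matrix.ext_iff]
  rintro (i | i | i) (j | j | j) <;> simp [soMatrix, mulVec_add] <;> ring

theorem soMatrix_smul (c : ℝ) (x : MidIdx p q → ℝ) (a : ℝ)
    (S : (MidIdx p q → ℝ) →ₗ[ℝ] MidIdx p q → ℝ) (w : MidIdx p q → ℝ) :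
    soMatrix p q (c • x) (c * a) (c • S) (c • w) = c • soMatrix p q x a S w := by
  rw [← Matrix.ext_iff]
  rintro (i | i | i) (j | j | j) <;> simp [soMatrix, mulVec_smul]

theorem soMatrix_sub (x x' : MidIdx p q → ℝ) (a a' : ℝ)
    (S S' : (MidIdx p q → ℝ) →ₗ[ℝ] MidIdx p q → ℝ) (w w' : MidIdx p q → ℝ) :
    soMatrix p q (x - x') (a - a') (S - S') (w - w') =
      soMatrix p q x a S w - soMatrix p q x' a' S' w' := by
  rw [eq_sub_iff_add_eq, ← soMatrix_add]
  simp

theorem soMatrix_inj {x x' : MidIdx p q → ℝ} {a a' : ℝ}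
    {S S' : (MidIdx p q → ℝ) →ₗ[ℝ] MidIdx p q → ℝ} {w w' : MidIdx p q → ℝ}
    (h : soMatrix p q x a S w = soMatrix p q x' a' S' w') : a = a' ∧ S = S' := by
  constructor
  · simpa [soMatrix] using congrFun (congrFun h (Sum.inl ())) (Sum.inl ())
  · apply LinearMap.toMatrix'.injective
    ext i j
    simpa [soMatrix] using congrFun (congrFun h (Sum.inr (Sum.inl i))) (Sum.inr (Sum.inl j))

theorem soMatrix_zero : soMatrix p q 0 0 0 0 = 0 := by
  rw [← Matrix.ext_iff]
  rintro (i | i | i) (j | j | j) <;> simp [soMatrix]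

theorem dualMatrix_eq_soMatrix (φ : Module.Dual ℝ (MidIdx p q → ℝ)) :
    dualMatrix p q φ = soMatrix p q 0 0 0 (nuMatrix p q *ᵥ fun j => φ (Pi.single j 1)) := by
  rw [← Matrix.ext_iff]
  rintro (i | i | i) (j | j | j) <;>
    simp [soMatrix, dualMatrix, -mulVec_mulVec, nuMatrix_mulVec_mulVec]

theorem nuBil_nuMatrix_mulVec (φ : Module.Dual ℝ (MidIdx p q → ℝ)) (y : MidIdx p q → ℝ) :
    nuBil p q (nuMatrix p q *ᵥ fun j => φ (Pi.single j 1)) y = φ y := by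
  rw [nuBil_comm, nuBil_apply, nuMatrix_mulVec_mulVec, φ.pi_apply_eq_sum_univ, dotProduct]
  refine Finset.sum_congr rfl fun i _ => ?_
  rw [smul_eq_mul]
  congr 2
  ext j
  simp [Pi.single_apply, eq_comm]

/-! ### The components of the curvature. -/

section Curvature

variable {V L : Type*} [AddCommGroup V] [Module ℝ V] [LieRing L] [LieAlgebra ℝ L]
  (B : LinearMap.BilinForm ℝ V) (θ : L →ₗ[ℝ] V) (a : L →ₗ[ℝ] ℝ) (S : L →ₗ[ℝ] V →ₗ[ℝ] V)
  (w : L →ₗ[ℝ] V)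

/-- The `ℝⁿ`-component of `{α X, α Y} - α [X, Y]` for `α = (θ, a, S, w)`. -/
def curvX (X Y : L) : V := (S X (θ Y) - a X • θ Y) - (S Y (θ X) - a Y • θ X) - θ ⁅X, Y⁆

/-- The scalar component of `{α X, α Y} - α [X, Y]` for `α = (θ, a, S, w)`. -/
def curvA (X Y : L) : ℝ := B (w X) (θ Y) - B (w Y) (θ X) - a ⁅X, Y⁆

/-- The skew component of `{α X, α Y} - α [X, Y]` for `α = (θ, a, S, w)`. -/
def curvS (X Y : L) : V →ₗ[ℝ] V :=
  S X ∘ₗ S Y - S Y ∘ₗ S X + (B (w Y)).smulRight (θ X) - (B (w X)).smulRight (θ Y)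
    + (B (θ Y)).smulRight (w X) - (B (θ X)).smulRight (w Y) - S ⁅X, Y⁆

/-- The `ℝⁿ*`-component of `{α X, α Y} - α [X, Y]` for `α = (θ, a, S, w)`. -/
def curvW (X Y : L) : V := (S X (w Y) + a X • w Y) - (S Y (w X) + a Y • w X) - w ⁅X, Y⁆

/-- The adjoint action of minus the `𝔠𝔬`-component of the curvature on covectors. -/
noncomputable def curvCo : L →ₗ[ℝ] L →ₗ[ℝ] V →ₗ[ℝ] V :=
  LinearMap.mk₂ ℝ (fun X Y => curvA B θ a w X Y • LinearMap.id - curvS B θ S w X Y)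
    (fun X X' Y => by
      ext v
      simp only [curvA, curvS, map_add, add_lie, LinearMap.add_apply, LinearMap.sub_apply,
        LinearMap.smul_apply, LinearMap.comp_apply, LinearMap.smulRight_apply, LinearMap.id_apply]
      module)
    (fun c X Y => by
      ext v
      simp only [curvA, curvS, map_smul, smul_lie, LinearMap.add_apply, LinearMap.sub_apply,
        LinearMap.smul_apply, LinearMap.comp_apply, LinearMap.smulRight_apply, LinearMap.id_apply,
        smul_eq_mul]
      module)
    (fun X Y Y' => by
      ext v
      simp only [curvA, curvS, map_add, lie_add, LinearMap.add_apply, LinearMap.sub_apply,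
        LinearMap.smul_apply, LinearMap.comp_apply, LinearMap.smulRight_apply, LinearMap.id_apply]
      module)
    (fun c X Y => by
      ext v
      simp only [curvA, curvS, map_smul, lie_smul, LinearMap.add_apply, LinearMap.sub_apply,
        LinearMap.smul_apply, LinearMap.comp_apply, LinearMap.smulRight_apply, LinearMap.id_apply,
        smul_eq_mul]
      module)

theorem curvCo_apply (X Y : L) (v : V) :
    curvCo B θ a S w X Y v = curvA B θ a w X Y • v - curvS B θ S w X Y v := rfl

theorem curvA_swap (X Y : L) : curvA B θ a w X Y = -curvA B θ a w Y X := by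
  rw [curvA, curvA, ← lie_skew X Y, map_neg]
  ring

theorem curvS_swap (X Y : L) : curvS B θ S w X Y = -curvS B θ S w Y X := by
  rw [curvS, curvS, ← lie_skew X Y, map_neg]
  abel

theorem curvCo_swap (X Y : L) : curvCo B θ a S w X Y = -curvCo B θ a S w Y X := by
  ext v
  rw [LinearMap.neg_apply, curvCo_apply, curvCo_apply, curvA_swap, curvS_swap,
    LinearMap.neg_apply]
  module

variable {B S}

theorem curvS_skew (hB : ∀ u v, B u v = B v u) (hS : ∀ X u v, B (S X u) v = -B u (S X v))
    (X Y : L) (u v : V) : B (curvS B θ S w X Y u) v = -B u (curvS B θ S w X Y v) := by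
  simp only [curvS, map_add, map_sub, LinearMap.add_apply, LinearMap.sub_apply,
    LinearMap.comp_apply, LinearMap.smulRight_apply, map_smul, LinearMap.smul_apply, smul_eq_mul,
    hS]
  rw [hB u (θ X), hB u (θ Y), hB u (w X), hB u (w Y)]
  ring

end Curvature

/-! ### From components to a normal connection. -/

section Assembly

variable {L : Type*} [LieRing L] [LieAlgebra ℝ L]
  (θ : L →ₗ[ℝ] MidIdx p q → ℝ) (a : L →ₗ[ℝ] ℝ)
  (S : L →ₗ[ℝ] (MidIdx p q → ℝ) →ₗ[ℝ] MidIdx p q → ℝ)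
  (hS : ∀ X u v, nuBil p q (S X u) v = -nuBil p q u (S X v)) (w : L →ₗ[ℝ] MidIdx p q → ℝ)

/-- The linear map into `𝔰𝔬(p+1,q+1)` with the given components. -/
noncomputable def soMap : L →ₗ[ℝ] soAlg p q where
  toFun X := soElt (θ X) (a X) (S X) (hS X) (w X)
  map_add' X Y := Subtype.ext <| by simp only [soElt, map_add, soMatrix_add]; rfl
  map_smul' c X := Subtype.ext <| by
    simp only [soElt, map_smul, smul_eq_mul, soMatrix_smul]; rfl

theorem soMap_curvature (X Y : L) :
    ((⁅soMap θ a S hS w X, soMap θ a S hS w Y⁆ - soMap θ a S hS w ⁅X, Y⁆ : soAlg p q) :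
      Matrix (TractorIdx p q) (TractorIdx p q) ℝ) =
    soMatrix p q (curvX θ a S X Y) (curvA (nuBil p q) θ a w X Y) (curvS (nuBil p q) θ S w X Y)
      (curvW a S w X Y) := by
  have h := soMatrix_lie (θ X) (θ Y) (a X) (a Y) (hS X) (hS Y) (w X) (w Y)
  change ⁅soMatrix p q _ _ _ _, soMatrix p q _ _ _ _⁆ - soMatrix p q _ _ _ _ = _
  rw [h, ← soMatrix_sub]
  rfl

end Assembly

section Assembly

variable {p q : ℕ} {L : Type*} [LieRing L] [LieAlgebra ℝ L]

/-- The bilinear map `(X, Y) ↦ {α X, α Y} - α [X, Y]`. -/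
noncomputable def curvature (α : L →ₗ[ℝ] soAlg p q) : L →ₗ[ℝ] L →ₗ[ℝ] soAlg p q :=
  LinearMap.mk₂ ℝ (fun X Y => ⁅α X, α Y⁆ - α ⁅X, Y⁆)
    (fun X X' Y => by simp only [map_add, add_lie]; abel)
    (fun c X Y => by simp only [map_smul, smul_lie, smul_sub])
    (fun X Y Y' => by simp only [map_add, lie_add]; abel)
    (fun c X Y => by simp only [map_smul, lie_smul, smul_sub])

theorem curvature_apply (α : L →ₗ[ℝ] soAlg p q) (X Y : L) :
    curvature α X Y = ⁅α X, α Y⁆ - α ⁅X, Y⁆ := rfl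

theorem curvature_self (α : L →ₗ[ℝ] soAlg p q) (X : L) : curvature α X X = 0 := by
  rw [curvature_apply, lie_self, lie_self, map_zero, sub_zero]

theorem curvature_swap (α : L →ₗ[ℝ] soAlg p q) (X Y : L) :
    curvature α X Y = -curvature α Y X := by
  rw [curvature_apply, curvature_apply, ← lie_skew, ← lie_skew X Y, map_neg]
  abel

/-- An alternating bilinear map, as an alternating map on `Fin 2`-families. -/
def LinearMap.toAlternatingMapFinTwo {V W : Type*} [AddCommGroup V] [Module ℝ V] [AddCommGroup W]
    [Module ℝ W] (β : V →ₗ[ℝ] V →ₗ[ℝ] W) (h : ∀ v, β v v = 0) : V [⋀^Fin 2]→ₗ[ℝ] W where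
  toFun m := β (m 0) (m 1)
  map_update_add' m i x y := by fin_cases i <;> simp [Function.update]
  map_update_smul' m i c x := by fin_cases i <;> simp [Function.update]
  map_eq_zero_of_eq' m i j hm hij := by
    fin_cases i <;> fin_cases j <;> simp_all

theorem LinearMap.toAlternatingMapFinTwo_apply {V W : Type*} [AddCommGroup V] [Module ℝ V]
    [AddCommGroup W] [Module ℝ W] (β : V →ₗ[ℝ] V →ₗ[ℝ] W) (h : ∀ v, β v v = 0) (u v : V) :
    β.toAlternatingMapFinTwo h ![u, v] = β u v := rfl

variable (θ : L →ₗ[ℝ] MidIdx p q → ℝ) (a : L →ₗ[ℝ] ℝ)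
  (S : L →ₗ[ℝ] (MidIdx p q → ℝ) →ₗ[ℝ] MidIdx p q → ℝ)
  (w : L →ₗ[ℝ] MidIdx p q → ℝ)

/-- The bracket of a covector with an element of `𝔭` is again a covector. Pairing it with `v` and
moving the skew map across `ν` turns each summand, up to sign, into a diagonal entry in the basis
`b`. The normalization condition thus becomes a vanishing trace. -/
theorem sum_lie_dualEmb_eq_zero {ι : Type*} [Fintype ι] [DecidableEq ι]
    (b : Module.Basis ι ℝ (MidIdx p q → ℝ)) (A : ι → soAlg p q)
    (c : ι → ℝ) (T : ι → (MidIdx p q → ℝ) →ₗ[ℝ] MidIdx p q → ℝ) (z : ι → MidIdx p q → ℝ)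
    (hT : ∀ i u v, nuBil p q (T i u) v = -nuBil p q u (T i v))
    (hA : ∀ i, (A i : Matrix (TractorIdx p q) (TractorIdx p q) ℝ) = soMatrix p q 0 (c i) (T i) (z i))
    (h : ∀ v, ∑ i, b.coord i (c i • v - T i v) = 0) :
    ∑ i, ⁅dualEmb p q (b.coord i), A i⁆ = 0 := by
  have h0 : ∀ u v : MidIdx p q → ℝ, nuBil p q ((0 : (MidIdx p q → ℝ) →ₗ[ℝ] MidIdx p q → ℝ) u) v =
      -nuBil p q u ((0 : (MidIdx p q → ℝ) →ₗ[ℝ] MidIdx p q → ℝ) v) := by simp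
  let ζ : ι → MidIdx p q → ℝ := fun i => nuMatrix p q *ᵥ fun j => b.coord i (Pi.single j 1)
  have h1 : ∀ i, ((⁅dualEmb p q (b.coord i), A i⁆ : soAlg p q) :
      Matrix (TractorIdx p q) (TractorIdx p q) ℝ) =
      soMatrix p q 0 0 0 (-(T i (ζ i) + c i • ζ i)) := by
    intro i
    rw [LieSubalgebra.coe_bracket, hA]
    change ⁅dualMatrix p q (b.coord i), _⁆ = _
    rw [dualMatrix_eq_soMatrix, soMatrix_lie _ _ _ _ h0 (hT i)]
    congr 1 <;> simp [ζ]
  have h2 : ∀ s : Finset ι, ((∑ i ∈ s, ⁅dualEmb p q (b.coord i), A i⁆ : soAlg p q) :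
      Matrix (TractorIdx p q) (TractorIdx p q) ℝ) =
      soMatrix p q 0 0 0 (∑ i ∈ s, -(T i (ζ i) + c i • ζ i)) := by
    intro s
    induction s using Finset.induction_on with
    | empty => simp [soMatrix_zero]
    | insert i s hi ih =>
      rw [Finset.sum_insert hi, Finset.sum_insert hi, AddMemClass.coe_add, ih, h1,
        ← soMatrix_add]
      simp
  apply Subtype.ext
  rw [h2]
  have h3 : ∑ i, -(T i (ζ i) + c i • ζ i) = 0 := by
    apply (nuBil_nondegenerate p q).1
    intro v
    rw [map_sum, LinearMap.sum_apply, ← neg_eq_zero, ← h v, ← Finset.sum_neg_distrib]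
    refine Finset.sum_congr rfl fun i _ => ?_
    rw [← nuBil_nuMatrix_mulVec (b.coord i)]
    simp only [map_neg, map_add, map_sub, LinearMap.neg_apply, LinearMap.add_apply, hT, map_smul,
      LinearMap.smul_apply, ζ]
    ring
  rw [h3, soMatrix_zero]
  rfl

/-- There is an infinitesimally equivariant Cartan connection `α` of type `(𝔰𝔬(p+1,q+1), 𝔭)` with
`ℝⁿ`-component `θ` whose curvature is normalized. -/
def HasNormalConnection (θ : L →ₗ[ℝ] MidIdx p q → ℝ) : Prop :=
  ∃ α : L →ₗ[ℝ] soAlg p q,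
    (∀ Y₁ Yh, θ Yh = 0 → ⁅α Y₁, α Yh⁆ - α ⁅Y₁, Yh⁆ = 0) ∧
    (∀ Y, vectorPart p q (α Y) = θ Y) ∧
    ∃ κ : (soAlg p q ⧸ parabolic p q) [⋀^Fin 2]→ₗ[ℝ] soAlg p q,
      (∀ Y₁ Y₂, κ ![(parabolic p q).mkQ (α Y₁), (parabolic p q).mkQ (α Y₂)] =
          ⁅α Y₁, α Y₂⁆ - α ⁅Y₁, Y₂⁆) ∧
      ∀ (b : Module.Basis (MidIdx p q) ℝ (MidIdx p q → ℝ)) (X : MidIdx p q → L),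
        (∀ i, θ (X i) = b i) → ∀ Y, ∑ i, ⁅dualEmb p q (b.coord i),
          κ ![(parabolic p q).mkQ (α Y), (parabolic p q).mkQ (α (X i))]⁆ = 0

/-- A curvature that vanishes along `ker θ` depends only on the classes modulo `𝔭`, so composing it
with a section `s` of `θ` defines `κ`. The normalization is a trace, independent of basis and
representatives, so checking it for `s` suffices. -/
theorem hasNormalConnection_of_components {θ : L →ₗ[ℝ] MidIdx p q → ℝ} (s : (MidIdx p q → ℝ) →ₗ[ℝ] L)
    (hs : ∀ v, θ (s v) = v) (hS : ∀ X u v, nuBil p q (S X u) v = -nuBil p q u (S X v))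
    (hX : ∀ X Y, curvX θ a S X Y = 0)
    (hA : ∀ X, θ X = 0 → ∀ Y, curvA (nuBil p q) θ a w X Y = 0)
    (hSS : ∀ X, θ X = 0 → ∀ Y, curvS (nuBil p q) θ S w X Y = 0)
    (hW : ∀ X, θ X = 0 → ∀ Y, curvW a S w X Y = 0)
    (hNor : ∀ Y v, LinearMap.trace ℝ _ ((curvCo (nuBil p q) θ a S w Y ∘ₗ s).flip v) = 0) :
    HasNormalConnection θ := by
  obtain ⟨α, hvec, hcurv⟩ : ∃ α : L →ₗ[ℝ] soAlg p q, (∀ Y, vectorPart p q (α Y) = θ Y) ∧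
      ∀ X Y, (curvature α X Y : Matrix (TractorIdx p q) (TractorIdx p q) ℝ) =
        soMatrix p q 0 (curvA (nuBil p q) θ a w X Y) (curvS (nuBil p q) θ S w X Y)
          (curvW a S w X Y) :=
    ⟨soMap θ a S hS w, fun Y => rfl, fun X Y => by
      rw [curvature_apply, soMap_curvature, hX]⟩
  have hker : ∀ X, θ X = 0 → ∀ Y, curvature α X Y = 0 := fun X h Y => by
    apply Subtype.ext
    rw [hcurv, hA X h, hSS X h, hW X h, soMatrix_zero]
    rfl
  have hker' : ∀ X Y, θ Y = 0 → curvature α X Y = 0 := fun X Y h => by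
    rw [curvature_swap, hker Y h, neg_zero]
  have hred : ∀ X Y, curvature α (s (θ X)) (s (θ Y)) = curvature α X Y := fun X Y => by
    have h1 := hker (s (θ X) - X) (by rw [map_sub, hs, sub_self]) (s (θ Y))
    have h2 := hker' X (s (θ Y) - Y) (by rw [map_sub, hs, sub_self])
    rw [map_sub, LinearMap.sub_apply, sub_eq_zero] at h1
    rw [map_sub, sub_eq_zero] at h2
    rw [h1, h2]
  let e : (soAlg p q ⧸ parabolic p q) →ₗ[ℝ] MidIdx p q → ℝ :=
    (parabolic p q).liftQ (vectorPart p q) le_rfl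
  let β := (curvature α).compl₁₂ (s ∘ₗ e) (s ∘ₗ e)
  have he : ∀ Y, e ((parabolic p q).mkQ (α Y)) = θ Y := fun Y => by
    rw [← hvec]
    exact (parabolic p q).liftQ_apply (vectorPart p q) (α Y)
  have hβ : ∀ u, β u u = 0 := fun u => by
    rw [LinearMap.compl₁₂_apply, curvature_self]
  have hκ : ∀ Y₁ Y₂, β.toAlternatingMapFinTwo hβ
      ![(parabolic p q).mkQ (α Y₁), (parabolic p q).mkQ (α Y₂)] = curvature α Y₁ Y₂ :=
    fun Y₁ Y₂ => by
      rw [LinearMap.toAlternatingMapFinTwo_apply, LinearMap.compl₁₂_apply, LinearMap.comp_apply,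
        LinearMap.comp_apply, he, he, hred]
  refine ⟨α, fun Y₁ Yh h => hker' Y₁ Yh h, hvec, _, hκ, fun b X hXb Y => ?_⟩
  simp only [hκ]
  refine sum_lie_dualEmb_eq_zero b _ _ _ _ (fun i => curvS_skew θ w (nuBil_comm p q) hS Y (X i))
    (fun i => hcurv Y (X i)) fun v => ?_
  rw [← hNor Y v, LinearMap.trace_eq_matrix_trace ℝ b, Matrix.trace]
  refine Finset.sum_congr rfl fun i _ => ?_
  rw [diag_apply, LinearMap.toMatrix_apply, LinearMap.flip_apply, LinearMap.comp_apply,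
    ← Module.Basis.coord_apply]
  congr 1
  -- The section and the given representatives differ by elements of `ker θ`, which the curvature
  -- does not see.
  have h1 : curvCo (nuBil p q) θ a S w Y (s (b i) - X i) = 0 := by
    have h0 : θ (s (b i) - X i) = 0 := by rw [map_sub, hs, hXb, sub_self]
    refine LinearMap.ext fun v => ?_
    rw [curvCo_apply, curvA_swap, curvS_swap, hA _ h0, hSS _ h0]
    simp
  rw [map_sub, sub_eq_zero] at h1
  rw [h1, curvCo_apply]

end Assembly

/-! ### The Koszul formula and the Ricci operator. -/

section LinearAlgebra

theorem LinearMap.BilinForm.Nondegenerate.eq_zero {V : Type*} [AddCommGroup V] [Module ℝ V]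
    {B : LinearMap.BilinForm ℝ V} (hB : B.Nondegenerate) {x : V} (h : ∀ v, B x v = 0) : x = 0 :=
  hB.1 x h

theorem exists_apply_eq_one {V : Type*} [AddCommGroup V] [Module ℝ V] [Nontrivial V]
    {B : LinearMap.BilinForm ℝ V} (hB : B.Nondegenerate) : ∃ u v, B u v = 1 := by
  obtain ⟨u, hu⟩ := exists_ne (0 : V)
  obtain ⟨v, hv⟩ : ∃ v, B u v ≠ 0 := by
    by_contra! h
    exact hu (hB.eq_zero h)
  exact ⟨u, (B u v)⁻¹ • v, by rw [map_smul, smul_eq_mul, inv_mul_cancel₀ hv]⟩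

variable {V : Type*} [AddCommGroup V] [Module ℝ V] [FiniteDimensional ℝ V]
  {B : LinearMap.BilinForm ℝ V}

/-- The Koszul formula: every alternating bracket is the antisymmetrization of a unique linear map
into skew endomorphisms. -/
theorem exists_skew_of_bracket (hs : ∀ u v, B u v = B v u) (hB : B.Nondegenerate)
    (t : V →ₗ[ℝ] V →ₗ[ℝ] V) (ht : ∀ u v, t u v = -t v u) :
    ∃ K : V →ₗ[ℝ] V →ₗ[ℝ] V, (∀ u v x, B (K u v) x = -B v (K u x)) ∧
      ∀ u v, K u v - K v u = t u v := by
  let β : V →ₗ[ℝ] V →ₗ[ℝ] Module.Dual ℝ V :=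
    LinearMap.mk₂ ℝ (fun u v => (1 / 2 : ℝ) • (B (t u v) - B v ∘ₗ t u - B u ∘ₗ t v))
      (fun u u' v => by ext; simp; ring) (fun c u v => by ext; simp; ring)
      (fun u v v' => by ext; simp; ring) (fun c u v => by ext; simp; ring)
  let K : V →ₗ[ℝ] V →ₗ[ℝ] V := β.compr₂ (B.toDual hB).symm.toLinearMap
  have hK : ∀ u v x, B (K u v) x = 1 / 2 * (B (t u v) x - B v (t u x) - B u (t v x)) := by
    intro u v x
    change B ((B.toDual hB).symm (β u v)) x = _
    rw [LinearMap.BilinForm.apply_toDual_symm_apply]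
    simp [β]
  refine ⟨K, fun u v x => ?_, fun u v => ?_⟩
  · rw [hs v, hK, hK, ht x v, hs x, hs v, map_neg]
    ring
  · rw [← sub_eq_zero]
    apply hB.eq_zero
    intro x
    rw [map_sub, map_sub, LinearMap.sub_apply, LinearMap.sub_apply, hK, hK, ht v u, map_neg,
      LinearMap.neg_apply]
    ring

/-- The effect on the Ricci-type contraction of changing the `ℝⁿ*`-component of a Cartan
connection by `P`, before taking the trace. -/
noncomputable def ricOp (B : LinearMap.BilinForm ℝ V) (P : V →ₗ[ℝ] V) (y v : V) : V →ₗ[ℝ] V :=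
  (B (P y)).smulRight v - (B y ∘ₗ P).smulRight v - (B v ∘ₗ P).smulRight y
    + B (P y) v • LinearMap.id - (B v).smulRight (P y) + B y v • P

theorem trace_ricOp (hs : ∀ u v, B u v = B v u) (P : V →ₗ[ℝ] V) (y v : V) :
    LinearMap.trace ℝ V (ricOp B P y v) = ((Module.finrank ℝ V : ℝ) - 1) * B (P y) v
      - B y (P v) + LinearMap.trace ℝ V P * B y v := by
  simp only [ricOp, map_add, map_sub, LinearMap.trace_smulRight, map_smul, LinearMap.comp_apply,
    smul_eq_mul, LinearMap.trace_id]
  rw [hs v (P y)]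
  ring

/-- The skew part of the equation is `n` times the skew part of `P`. For symmetric `P` the equation
reads `(n - 2) P + tr P • id = 0`, whose trace is `(2n - 2) tr P = 0`. Only the final division by `n
- 2` needs `n ≥ 3`. -/
theorem eq_zero_of_trace_ricOp (hs : ∀ u v, B u v = B v u) (hB : B.Nondegenerate)
    (hn : 3 ≤ Module.finrank ℝ V) {P : V →ₗ[ℝ] V}
    (h : ∀ y v, LinearMap.trace ℝ V (ricOp B P y v) = 0) : P = 0 := by
  have hn' : (3 : ℝ) ≤ Module.finrank ℝ V := by exact_mod_cast hn
  simp only [trace_ricOp hs] at h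
  have hsymm : ∀ y v, B (P y) v = B y (P v) := by
    intro y v
    have h1 := h y v
    have h2 := h v y
    rw [hs (P v) y, hs v (P y), hs v y] at h2
    have : (Module.finrank ℝ V : ℝ) * (B (P y) v - B y (P v)) = 0 := by linarith
    rcases mul_eq_zero.1 this with h3 | h3 <;> linarith
  have h1 : ∀ y, ((Module.finrank ℝ V : ℝ) - 2) • P y + LinearMap.trace ℝ V P • y = 0 := by
    intro y
    apply hB.eq_zero
    intro v
    have := h y v
    rw [← hsymm] at this
    simp only [map_add, map_smul, LinearMap.add_apply, LinearMap.smul_apply, smul_eq_mul]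
    linarith
  have h2 : ((Module.finrank ℝ V : ℝ) - 2) • P + LinearMap.trace ℝ V P • LinearMap.id = 0 :=
    LinearMap.ext h1
  have h3 := congrArg (LinearMap.trace ℝ V) h2
  rw [map_add, map_smul, map_smul, map_zero, LinearMap.trace_id, smul_eq_mul, smul_eq_mul] at h3
  have h4 : LinearMap.trace ℝ V P = 0 := by
    have : (2 * (Module.finrank ℝ V : ℝ) - 2) * LinearMap.trace ℝ V P = 0 := by linarith
    rcases mul_eq_zero.1 this with h5 | h5
    · linarith
    · exact h5
  rw [h4, zero_smul, add_zero] at h2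
  rcases smul_eq_zero.1 h2 with h5 | h5
  · linarith
  · exact h5

/-- Endomorphisms and bilinear forms have the same dimension, so injectivity gives surjectivity. -/
theorem exists_trace_ricOp_eq (hs : ∀ u v, B u v = B v u) (hB : B.Nondegenerate)
    (hn : 3 ≤ Module.finrank ℝ V) (Q : V →ₗ[ℝ] V →ₗ[ℝ] ℝ) :
    ∃ P : V →ₗ[ℝ] V, ∀ y v, LinearMap.trace ℝ V (ricOp B P y v) = Q y v := by
  let R : (V →ₗ[ℝ] V) →ₗ[ℝ] V →ₗ[ℝ] V →ₗ[ℝ] ℝ :=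
    { toFun P := ((Module.finrank ℝ V : ℝ) - 1) • (B ∘ₗ P) - B.compl₂ P
        + LinearMap.trace ℝ V P • B
      map_add' P P' := by
        refine LinearMap.ext fun y => LinearMap.ext fun v => ?_
        simp
        ring
      map_smul' c P := by
        refine LinearMap.ext fun y => LinearMap.ext fun v => ?_
        simp
        ring }
  have hR : ∀ P y v, R P y v = LinearMap.trace ℝ V (ricOp B P y v) := fun P y v => by
    rw [trace_ricOp hs]
    simp [R]
  have hinj : Function.Injective R := by
    rw [injective_iff_map_eq_zero]
    intro P hP
    exact eq_zero_of_trace_ricOp hs hB hn fun y v => by rw [← hR, hP]; rfl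
  have hrank : Module.finrank ℝ (V →ₗ[ℝ] V) = Module.finrank ℝ (V →ₗ[ℝ] V →ₗ[ℝ] ℝ) := by
    rw [Module.finrank_linearMap ℝ ℝ V V, Module.finrank_linearMap ℝ ℝ V (V →ₗ[ℝ] ℝ),
      Subspace.dual_finrank_eq]
  have hsurj : Function.Surjective R :=
    (@LinearMap.injective_iff_surjective_of_finrank_eq_finrank ℝ (V →ₗ[ℝ] V) _ _ _
      (V →ₗ[ℝ] V →ₗ[ℝ] ℝ) _ _ _ _ hrank R).1 hinj
  obtain ⟨P, hP⟩ := hsurj Q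
  exact ⟨P, fun y v => by rw [← hR, hP]⟩

end LinearAlgebra

/-! ### Removing the torsion. -/

section TorsionFree

variable {V L : Type*} [AddCommGroup V] [Module ℝ V] [FiniteDimensional ℝ V] [LieRing L]
  [LieAlgebra ℝ L] {B : LinearMap.BilinForm ℝ V} {θ : L →ₗ[ℝ] V}

theorem exists_torsionFree [Nontrivial V] (hs : ∀ u v, B u v = B v u) (hB : B.Nondegenerate)
    (s : V →ₗ[ℝ] L) (hθ : ∀ v, θ (s v) = v)
    (hiso : ∀ h, θ h = 0 → ∃ c : ℝ, ∀ Y Z,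
      B (θ ⁅h, Y⁆) (θ Z) + B (θ Y) (θ ⁅h, Z⁆) = c * B (θ Y) (θ Z)) :
    ∃ (a : L →ₗ[ℝ] ℝ) (S : L →ₗ[ℝ] V →ₗ[ℝ] V), (∀ X u v, B (S X u) v = -B u (S X v)) ∧
      ∀ X Y, curvX θ a S X Y = 0 := by
  -- That `ker θ` is a subalgebra need not be assumed: in the conformality relation for `h`, with
  -- `h'` as one argument, all terms but one contain `θ h' = 0`.
  have hsub : ∀ h h', θ h = 0 → θ h' = 0 → θ ⁅h, h'⁆ = 0 := by
    intro h h' hh hh'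
    obtain ⟨c, hc⟩ := hiso h hh
    apply hB.eq_zero
    intro v
    have := hc h' (s v)
    simpa [hh', hθ] using this
  obtain ⟨u₀, v₀, huv⟩ := exists_apply_eq_one hB
  obtain ⟨K, hK, hKt⟩ := exists_skew_of_bracket hs hB
    (LinearMap.mk₂ ℝ (fun u v => θ ⁅s u, s v⁆) (by simp) (by simp) (by simp) (by simp))
    (fun u v => by simp only [LinearMap.mk₂_apply]; rw [← lie_skew, map_neg])
  simp only [LinearMap.mk₂_apply] at hKt
  let l : L →ₗ[ℝ] V →ₗ[ℝ] V :=
    LinearMap.mk₂ ℝ (fun X v => θ ⁅X - s (θ X), s v⁆)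
      (fun X X' v => by
        rw [← map_add, ← add_lie]
        congr 2
        simp only [map_add]
        abel)
      (fun c X v => by simp only [map_smul, ← smul_sub, smul_lie]) (by simp) (by simp)
  have hl : ∀ X v, l X v = θ ⁅X - s (θ X), s v⁆ := fun X v => rfl
  have hπ : ∀ X, θ (X - s (θ X)) = 0 := fun X => by rw [map_sub, hθ, sub_self]
  let c : L →ₗ[ℝ] ℝ :=
    { toFun X := B (l X u₀) v₀ + B u₀ (l X v₀)
      map_add' X Y := by
        simp only [map_add, LinearMap.add_apply]
        ring
      map_smul' c X := by
        simp only [map_smul, LinearMap.smul_apply, smul_eq_mul, RingHom.id_apply]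
        ring }
  have hc : ∀ X u v, B (l X u) v + B u (l X v) = c X * B u v := by
    intro X u v
    obtain ⟨d, hd⟩ := hiso _ (hπ X)
    have h1 := hd (s u₀) (s v₀)
    have h2 := hd (s u) (s v)
    rw [hθ, hθ] at h1 h2
    rw [huv, mul_one] at h1
    rw [hl, hl, h2, ← h1]
    rfl
  -- The operator `S - a` is `l + K ∘ θ`: the isotropy action plus the Koszul operator of the
  -- bracket on the complement. The isotropy action scales `B` by `c`, so removing `c / 2` times the
  -- identity leaves a skew `S`.
  refine ⟨(-(1 / 2) : ℝ) • c, l + K ∘ₗ θ + LinearMap.toSpanSingleton ℝ _ LinearMap.id ∘ₗ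
    ((-(1 / 2) : ℝ) • c), fun X u v => ?_, fun X Y => ?_⟩
  · simp only [LinearMap.add_apply, LinearMap.comp_apply, LinearMap.toSpanSingleton_apply,
      LinearMap.smul_apply, LinearMap.id_apply, map_add, map_smul, smul_eq_mul, hK]
    linarith [hc X u v]
  · have h1 : ∀ X Y, l X (θ Y) = θ ⁅X - s (θ X), Y⁆ := by
      intro X Y
      have := hsub _ _ (hπ X) (hπ Y)
      rw [lie_sub, map_sub, sub_eq_zero] at this
      rw [hl, this]
    have h2 := hKt (θ X) (θ Y)
    have h3 := hsub _ _ (hπ X) (hπ Y)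
    simp only [curvX, LinearMap.add_apply, LinearMap.comp_apply, LinearMap.toSpanSingleton_apply,
      LinearMap.smul_apply, LinearMap.id_apply, h1]
    simp only [lie_sub, sub_lie, map_sub] at h3 ⊢
    rw [← lie_skew Y X, ← lie_skew (s (θ Y)) X, map_neg, map_neg]
    linear_combination (norm := module) h2 + h3

end TorsionFree

/-! ### The first prolongation of `𝔠𝔬` and the isotropy algebra. -/

section Prolongation

variable {V L : Type*} [AddCommGroup V] [Module ℝ V] [LieRing L]
  [LieAlgebra ℝ L] {B : LinearMap.BilinForm ℝ V} {θ : L →ₗ[ℝ] V} {a : L →ₗ[ℝ] ℝ}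
  {S : L →ₗ[ℝ] V →ₗ[ℝ] V}

theorem map_lie_of_torsionFree (hX : ∀ X Y, curvX θ a S X Y = 0) (X Y : L) :
    θ ⁅X, Y⁆ = (S X (θ Y) - a X • θ Y) - (S Y (θ X) - a Y • θ X) :=
  (sub_eq_zero.1 (hX X Y)).symm

theorem map_lie_of_torsionFree_of_ker (hX : ∀ X Y, curvX θ a S X Y = 0) {h : L} (hh : θ h = 0)
    (Y : L) : θ ⁅h, Y⁆ = S h (θ Y) - a h • θ Y := by
  rw [map_lie_of_torsionFree hX, hh]
  simp

/-- The algebraic Bianchi identity with one argument in the isotropy algebra: the curvature of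
`S - a` takes values in the first prolongation of `𝔠𝔬`. -/
theorem curvature_symm_of_ker (hX : ∀ X Y, curvX θ a S X Y = 0) {h : L} (hh : θ h = 0) (Y Z : L) :
    S h (S Y (θ Z)) - S Y (S h (θ Z)) - S ⁅h, Y⁆ (θ Z) + a ⁅h, Y⁆ • θ Z =
      S h (S Z (θ Y)) - S Z (S h (θ Y)) - S ⁅h, Z⁆ (θ Y) + a ⁅h, Z⁆ • θ Y := by
  have h1 := congrArg θ (leibniz_lie h Y Z)
  rw [map_add, map_lie_of_torsionFree_of_ker hX hh, map_lie_of_torsionFree hX Y Z,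
    map_lie_of_torsionFree hX ⁅h, Y⁆ Z, map_lie_of_torsionFree hX Y ⁅h, Z⁆,
    map_lie_of_torsionFree_of_ker hX hh, map_lie_of_torsionFree_of_ker hX hh] at h1
  simp only [map_sub, map_smul] at h1
  linear_combination (norm := module) h1

/-- The form on the left is symmetric in `Y` and `Z` by the Bianchi identity, and its symmetrization
in `Z` and `T` is known because `S` is skew. As with Christoffel symbols, an alternating sum over
three permutations determines it. -/
theorem two_mul_curvature_of_ker (hs : ∀ u v, B u v = B v u)
    (hS : ∀ X u v, B (S X u) v = -B u (S X v))
    (hX : ∀ X Y, curvX θ a S X Y = 0) {h : L} (hh : θ h = 0) (Y Z T : L) :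
    B (S h (S Y (θ Z)) - S Y (S h (θ Z)) - S ⁅h, Y⁆ (θ Z) + a ⁅h, Y⁆ • θ Z) (θ T) =
      a ⁅h, Y⁆ * B (θ Z) (θ T) + a ⁅h, Z⁆ * B (θ Y) (θ T) - a ⁅h, T⁆ * B (θ Y) (θ Z) := by
  have hsymm := fun Y Z => congrArg B (curvature_symm_of_ker hX hh Y Z)
  have hskew : ∀ Y Z T,
      B (S h (S Y (θ Z)) - S Y (S h (θ Z)) - S ⁅h, Y⁆ (θ Z) + a ⁅h, Y⁆ • θ Z) (θ T) +
      B (S h (S Y (θ T)) - S Y (S h (θ T)) - S ⁅h, Y⁆ (θ T) + a ⁅h, Y⁆ • θ T) (θ Z) =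
      2 * a ⁅h, Y⁆ * B (θ Z) (θ T) := by
    intro Y Z T
    rw [hs _ (θ Z)]
    simp only [map_add, map_sub, map_smul, LinearMap.add_apply, LinearMap.sub_apply,
      LinearMap.smul_apply, smul_eq_mul, hS]
    ring
  have h1 := hskew Y Z T
  have h2 := hskew Z Y T
  have h3 := hskew T Y Z
  rw [hsymm Z Y, hsymm Z T] at h2
  rw [hsymm T Y] at h3
  linear_combination (h1 + h2 - h3) / 2

/-- Exchanging `h'` with `Y` by the Bianchi symmetry makes the curvature vanish, since `θ h' = 0`,
while the prolongation formula evaluates it to a multiple of `a [h, h']`. Hence the functional `a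
[h, ·]` descends along `θ` and has a dual vector. -/
theorem map_lie_eq_zero_of_ker [Nontrivial V] (hs : ∀ u v, B u v = B v u) (hB : B.Nondegenerate)
    (hS : ∀ X u v, B (S X u) v = -B u (S X v)) (hX : ∀ X Y, curvX θ a S X Y = 0)
    (hθ : Function.Surjective θ) {h h' : L} (hh : θ h = 0) (hh' : θ h' = 0) : a ⁅h, h'⁆ = 0 := by
  obtain ⟨u, v, huv⟩ := exists_apply_eq_one hB
  obtain ⟨Y, rfl⟩ := hθ u
  obtain ⟨Z, rfl⟩ := hθ v
  have h1 := two_mul_curvature_of_ker hs hS hX hh h' Y Z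
  have h2 := curvature_symm_of_ker hX hh h' Y
  rw [h2, hh', huv] at h1
  simpa using h1.symm

/-- With this `w h`, the `w`-terms of the curvature cancel exactly the value found in
`two_mul_curvature_of_ker`. -/
theorem curv_eq_zero_of_ker (hs : ∀ u v, B u v = B v u) (hB : B.Nondegenerate)
    (hS : ∀ X u v, B (S X u) v = -B u (S X v)) (hX : ∀ X Y, curvX θ a S X Y = 0)
    (hθ : Function.Surjective θ) {w : L →ₗ[ℝ] V} {h : L} (hh : θ h = 0)
    (hw : ∀ Y, B (w h) (θ Y) = a ⁅h, Y⁆) (Y : L) :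
    curvA B θ a w h Y = 0 ∧ curvS B θ S w h Y = 0 := by
  constructor
  · rw [curvA, hh, hw]
    simp
  · refine LinearMap.ext fun v => hB.eq_zero fun t => ?_
    obtain ⟨Z, rfl⟩ := hθ v
    obtain ⟨T, rfl⟩ := hθ t
    have h1 := two_mul_curvature_of_ker hs hS hX hh Y Z T
    simp only [curvS, hh, map_add, map_sub, map_smul, LinearMap.add_apply, LinearMap.sub_apply,
      LinearMap.smul_apply, smul_eq_mul, LinearMap.comp_apply, LinearMap.smulRight_apply, hw,
      map_zero, LinearMap.zero_apply, smul_zero] at h1 ⊢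
    linear_combination h1

end Prolongation

/-! ### The Bianchi identity and invariance of the covector component. -/

section Bianchi

variable {p q : ℕ} {L : Type*} [LieRing L] [LieAlgebra ℝ L]
  {θ : L →ₗ[ℝ] MidIdx p q → ℝ} {a : L →ₗ[ℝ] ℝ}
  {S : L →ₗ[ℝ] (MidIdx p q → ℝ) →ₗ[ℝ] MidIdx p q → ℝ} {w : L →ₗ[ℝ] MidIdx p q → ℝ}

theorem bianchi_identity (α : L →ₗ[ℝ] soAlg p q) (X Y Z : L) :
    ⁅α X, curvature α Y Z⁆ + curvature α X ⁅Y, Z⁆ +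
      (⁅α Y, curvature α Z X⁆ + curvature α Y ⁅Z, X⁆) +
      (⁅α Z, curvature α X Y⁆ + curvature α Z ⁅X, Y⁆) = 0 := by
  have h1 := lie_jacobi (α X) (α Y) (α Z)
  have h2 := congrArg α (lie_jacobi X Y Z)
  simp only [curvature_apply, lie_sub, map_add, map_zero] at h1 h2 ⊢
  rw [← sub_eq_zero.2 (h1.trans h2.symm)]
  abel

theorem bianchi_components (hS : ∀ X u v, nuBil p q (S X u) v = -nuBil p q u (S X v))
    (hX : ∀ X Y, curvX θ a S X Y = 0) (X Y Z : L) :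
    (curvA (nuBil p q) θ a w X ⁅Y, Z⁆ - nuBil p q (curvW a S w Y Z) (θ X)) +
      (curvA (nuBil p q) θ a w Y ⁅Z, X⁆ - nuBil p q (curvW a S w Z X) (θ Y)) +
      (curvA (nuBil p q) θ a w Z ⁅X, Y⁆ - nuBil p q (curvW a S w X Y) (θ Z)) = 0 ∧
    ∀ v,
    (S X (curvS (nuBil p q) θ S w Y Z v) - curvS (nuBil p q) θ S w Y Z (S X v)
      + nuBil p q (curvW a S w Y Z) v • θ X - nuBil p q (θ X) v • curvW a S w Y Z
      + curvS (nuBil p q) θ S w X ⁅Y, Z⁆ v) +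
    (S Y (curvS (nuBil p q) θ S w Z X v) - curvS (nuBil p q) θ S w Z X (S Y v)
      + nuBil p q (curvW a S w Z X) v • θ Y - nuBil p q (θ Y) v • curvW a S w Z X
      + curvS (nuBil p q) θ S w Y ⁅Z, X⁆ v) +
    (S Z (curvS (nuBil p q) θ S w X Y v) - curvS (nuBil p q) θ S w X Y (S Z v)
      + nuBil p q (curvW a S w X Y) v • θ Z - nuBil p q (θ Z) v • curvW a S w X Y
      + curvS (nuBil p q) θ S w Z ⁅X, Y⁆ v) = 0 := by
  let α := soMap θ a S hS w
  have hcurv : ∀ X Y, (curvature α X Y : Matrix (TractorIdx p q) (TractorIdx p q) ℝ) =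
      soMatrix p q 0 (curvA (nuBil p q) θ a w X Y) (curvS (nuBil p q) θ S w X Y)
        (curvW a S w X Y) := fun X Y => by
    rw [curvature_apply, soMap_curvature, hX]
  have hlie : ∀ X Y Z, (⁅α X, curvature α Y Z⁆ + curvature α X ⁅Y, Z⁆ : soAlg p q).1 =
      soMatrix p q _ _ _ _ := fun X Y Z => by
    rw [AddMemClass.coe_add, LieSubalgebra.coe_bracket, hcurv, hcurv]
    change ⁅soMatrix p q _ _ _ _, _⁆ + _ = _
    rw [soMatrix_lie _ _ _ _ (hS X) (curvS_skew θ w (nuBil_comm p q) hS Y Z), ← soMatrix_add]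
  have h := congrArg Subtype.val (bianchi_identity α X Y Z)
  rw [AddMemClass.coe_add, AddMemClass.coe_add, hlie, hlie, hlie, ← soMatrix_add, ← soMatrix_add,
    ZeroMemClass.coe_zero, ← soMatrix_zero] at h
  obtain ⟨h1, h2⟩ := soMatrix_inj h
  constructor
  · simp only [map_zero] at h1
    linear_combination h1
  · intro v
    have h3 := LinearMap.congr_fun h2 v
    simp only [LinearMap.add_apply, LinearMap.sub_apply, LinearMap.comp_apply,
      LinearMap.smulRight_apply, map_zero, LinearMap.zero_apply] at h3
    linear_combination (norm := module) h3

theorem curvW_swap (X Y : L) : curvW a S w X Y = -curvW a S w Y X := by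
  rw [curvW, curvW, ← lie_skew X Y, map_neg]
  abel

/-- The curvature component `curvW h` measures the failure of `w` to be equivariant under `h`. It
descends to an endomorphism of `ℝⁿ`, whose Ricci trace is the effect of `h` on the contraction of
the curvature. That contraction is zero, so injectivity of the Ricci operator applies. -/
theorem curvW_eq_zero_of_ker (s : (MidIdx p q → ℝ) →ₗ[ℝ] L) (hs : ∀ v, θ (s v) = v)
    (hn : 3 ≤ Module.finrank ℝ (MidIdx p q → ℝ))
    (hS : ∀ X u v, nuBil p q (S X u) v = -nuBil p q u (S X v))
    (hX : ∀ X Y, curvX θ a S X Y = 0)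
    (hA : ∀ X, θ X = 0 → ∀ Y, curvA (nuBil p q) θ a w X Y = 0)
    (hSS : ∀ X, θ X = 0 → ∀ Y, curvS (nuBil p q) θ S w X Y = 0)
    (hNor : ∀ Y v, LinearMap.trace ℝ _ ((curvCo (nuBil p q) θ a S w Y ∘ₗ s).flip v) = 0)
    {h : L} (hh : θ h = 0) (Y : L) : curvW a S w h Y = 0 := by
  let e : L →ₗ[ℝ] MidIdx p q → ℝ :=
    { toFun := curvW a S w h
      map_add' Y Y' := by
        simp only [curvW, map_add, lie_add, LinearMap.add_apply, smul_add, add_smul]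
        abel
      map_smul' c Y := by
        simp only [curvW, map_smul, lie_smul, LinearMap.smul_apply, smul_eq_mul, mul_smul,
          RingHom.id_apply, smul_sub, smul_add]
        rw [smul_comm (a h) c] }
  have he : ∀ Y, curvW a S w h Y = e Y := fun Y => rfl
  have hA' : ∀ X Y, θ Y = 0 → curvA (nuBil p q) θ a w X Y = 0 := fun X Y hY => by
    rw [curvA_swap, hA Y hY, neg_zero]
  have hCo : ∀ X Y, θ Y = 0 → curvCo (nuBil p q) θ a S w X Y = 0 := fun X Y hY => by
    refine LinearMap.ext fun v => ?_
    rw [curvCo_apply, curvA_swap, curvS_swap, hA Y hY, hSS Y hY]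
    simp
  have hCo' : ∀ X Y, curvCo (nuBil p q) θ a S w X (s (θ Y)) = curvCo (nuBil p q) θ a S w X Y :=
    fun X Y => by
    rw [← sub_eq_zero, ← map_sub, hCo]
    rw [map_sub, hs, sub_self]
  -- In the scalar Bianchi identity for `h`, `Y`, `s v`, with `h` and `Y` both in `ker θ`, only the
  -- pairing of `e Y` with `v` survives.
  have hker : ∀ Y, θ Y = 0 → e Y = 0 := by
    intro Y hY
    apply (nuBil_nondegenerate p q).eq_zero
    intro v
    have h1 := (bianchi_components (w := w) hS hX h Y (s v)).1
    rw [hh, hY, hA h hh, hA Y hY, hs, he, hA' (s v) ⁅h, Y⁆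
      (by rw [map_lie_of_torsionFree_of_ker hX hh, hY]; simp)] at h1
    simpa using h1
  have heθ : ∀ Y, e Y = e (s (θ Y)) := fun Y => by
    rw [← sub_eq_zero, ← map_sub, hker]
    rw [map_sub, hs, sub_self]
  have hE : e ∘ₗ s = 0 := by
    refine eq_zero_of_trace_ricOp (nuBil_comm p q) (nuBil_nondegenerate p q) hn fun y v => ?_
    -- This is the `𝔠𝔬`-part of the Bianchi identity for `h`, `s y`, `s u`, read as an endomorphism
    -- in `u`. Under the trace the two compositions with `S h` cancel and the other terms vanish by
    -- `hNor`.
    have key : ricOp (nuBil p q) (e ∘ₗ s) y v =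
        S h ∘ₗ (curvCo (nuBil p q) θ a S w (s y) ∘ₗ s).flip v
        - (curvCo (nuBil p q) θ a S w (s y) ∘ₗ s).flip (S h v)
        - (curvCo (nuBil p q) θ a S w (s y) ∘ₗ s).flip v ∘ₗ S h
        + a h • (curvCo (nuBil p q) θ a S w (s y) ∘ₗ s).flip v
        - (curvCo (nuBil p q) θ a S w ⁅h, s y⁆ ∘ₗ s).flip v := by
      refine LinearMap.ext fun u => ?_
      obtain ⟨h1, h2⟩ := bianchi_components (w := w) hS hX h (s y) (s u)
      have h2 := h2 v
      have h3 : curvCo (nuBil p q) θ a S w (s y) ⁅s u, h⁆ v =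
          -(curvCo (nuBil p q) θ a S w (s y) (s (S h u)) v)
            + a h • curvCo (nuBil p q) θ a S w (s y) (s u) v := by
        rw [← lie_skew, map_neg, ← hCo' _ ⁅h, s u⁆, map_lie_of_torsionFree_of_ker hX hh, hs]
        simp only [map_sub, map_smul, LinearMap.neg_apply, LinearMap.sub_apply,
          LinearMap.smul_apply]
        module
      have h4 : curvCo (nuBil p q) θ a S w (s u) ⁅h, s y⁆ v =
          -curvCo (nuBil p q) θ a S w ⁅h, s y⁆ (s u) v := by
        rw [curvCo_swap, LinearMap.neg_apply]
      rw [curvW_swap (s u) h, he, he, hh, hA h hh] at h1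
      rw [curvW_swap (s u) h, he, he, hh, hSS h hh, hSS h hh, curvS_swap _ _ _ _ (s u) h,
        hSS h hh] at h2
      rw [curvCo_apply] at h3 h4
      simp only [ricOp, LinearMap.add_apply, LinearMap.sub_apply, LinearMap.comp_apply,
        LinearMap.smul_apply, LinearMap.flip_apply, LinearMap.smulRight_apply, LinearMap.id_apply,
        curvCo_apply _ _ _ _ _ (s y) (s u), map_sub, map_smul, map_neg, LinearMap.neg_apply,
        LinearMap.zero_apply, map_zero, hs] at h1 h2 h3 h4 ⊢
      rw [nuBil_comm p q (e (s u)) y] at h1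
      rw [nuBil_comm p q (e (s u)) v, nuBil_comm p q u v] at h2
      have h5 := congrArg (fun r : ℝ => r • v) h1
      linear_combination (norm := module) -h5 + h2 + h3 + h4
    rw [key]
    simp only [map_sub, map_add, map_smul, hNor]
    rw [LinearMap.trace_comp_comm']
    simp
  rw [he, heθ]
  exact LinearMap.congr_fun hE (θ Y)

end Bianchi

/-! ### Dimension at least three. -/

section HigherDimension

theorem ricOp_change {V L : Type*} [AddCommGroup V] [Module ℝ V] [LieRing L] [LieAlgebra ℝ L]
    {B : LinearMap.BilinForm ℝ V} {θ : L →ₗ[ℝ] V} {a : L →ₗ[ℝ] ℝ} {S : L →ₗ[ℝ] V →ₗ[ℝ] V}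
    (hB : ∀ u v, B u v = B v u) (s : V →ₗ[ℝ] L) (hs : ∀ v, θ (s v) = v) (w : L →ₗ[ℝ] V)
    (P : V →ₗ[ℝ] V) (Y : L) (v : V) :
    (curvCo B θ a S (w + P ∘ₗ θ) Y ∘ₗ s).flip v =
      (curvCo B θ a S w Y ∘ₗ s).flip v + ricOp B P (θ Y) v := by
  refine LinearMap.ext fun u => ?_
  simp only [LinearMap.flip_apply, LinearMap.comp_apply, LinearMap.add_apply, curvCo_apply, curvA,
    curvS, LinearMap.sub_apply, LinearMap.smulRight_apply, map_add, hs, ricOp,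
    LinearMap.smul_apply, LinearMap.id_apply]
  rw [hB v u, hB v (P u), hB (θ Y) (P u)]
  module

variable {p q : ℕ} {L : Type*} [LieRing L] [LieAlgebra ℝ L]

/-- The value of `w` on `ker θ` is dictated by the prolongation. The correction `P ∘ θ` does not
affect it and leaves enough freedom to cancel the contraction. -/
theorem hasNormalConnection_of_three_le {θ : L →ₗ[ℝ] MidIdx p q → ℝ}
    (hn : 3 ≤ Module.finrank ℝ (MidIdx p q → ℝ)) (s : (MidIdx p q → ℝ) →ₗ[ℝ] L)
    (hs : ∀ v, θ (s v) = v) {a : L →ₗ[ℝ] ℝ}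
    {S : L →ₗ[ℝ] (MidIdx p q → ℝ) →ₗ[ℝ] MidIdx p q → ℝ}
    (hS : ∀ X u v, nuBil p q (S X u) v = -nuBil p q u (S X v))
    (hX : ∀ X Y, curvX θ a S X Y = 0) : HasNormalConnection θ := by
  have : Nontrivial (MidIdx p q → ℝ) := Module.nontrivial_of_finrank_pos (R := ℝ) (by omega)
  have hB := nuBil_nondegenerate p q
  have hθ : Function.Surjective θ := fun v => ⟨s v, hs v⟩
  obtain ⟨w₀, hw₀⟩ : ∃ w₀ : L →ₗ[ℝ] MidIdx p q → ℝ,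
      ∀ X u, nuBil p q (w₀ X) u = a ⁅X - s (θ X), s u⁆ := by
    refine ⟨((nuBil p q).toDual hB).symm.toLinearMap ∘ₗ
      LinearMap.mk₂ ℝ (fun X u => a ⁅X - s (θ X), s u⁆)
        (fun X X' v => by
          rw [← map_add, ← add_lie]
          congr 2
          simp only [map_add]
          abel)
        (fun c X v => by simp only [map_smul, ← smul_sub, smul_lie]) (by simp) (by simp),
      fun X u => ?_⟩
    change nuBil p q (((nuBil p q).toDual hB).symm _) u = _
    rw [LinearMap.BilinForm.apply_toDual_symm_apply]
    rfl
  have hw₀' : ∀ X, θ X = 0 → ∀ Y, nuBil p q (w₀ X) (θ Y) = a ⁅X, Y⁆ := by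
    intro X h Y
    have := map_lie_eq_zero_of_ker (nuBil_comm p q) hB hS hX hθ h
      (h' := Y - s (θ Y)) (by rw [map_sub, hs, sub_self])
    rw [lie_sub, map_sub, sub_eq_zero] at this
    rw [hw₀, h, map_zero, sub_zero, this]
  have hker := fun (w : L →ₗ[ℝ] MidIdx p q → ℝ)
    (hw : ∀ X, θ X = 0 → ∀ Y, nuBil p q (w X) (θ Y) = a ⁅X, Y⁆) X h =>
    curv_eq_zero_of_ker (nuBil_comm p q) hB hS hX hθ h (hw X h)
  have hCo : ∀ X, θ X = 0 → curvCo (nuBil p q) θ a S w₀ X = 0 := fun X h => by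
    refine LinearMap.ext fun Y => LinearMap.ext fun v => ?_
    rw [curvCo_apply, (hker w₀ hw₀' X h Y).1, (hker w₀ hw₀' X h Y).2]
    simp
  obtain ⟨P, hP⟩ := exists_trace_ricOp_eq (nuBil_comm p q) hB hn
    (LinearMap.mk₂ ℝ (fun y v =>
        -LinearMap.trace ℝ _ ((curvCo (nuBil p q) θ a S w₀ (s y) ∘ₗ s).flip v))
      (fun y y' v => by
        rw [← neg_add, ← map_add, map_add, map_add]
        rfl)
      (fun c y v => by
        rw [smul_eq_mul, ← neg_mul_comm, neg_mul, ← smul_eq_mul, ← map_smul, map_smul, map_smul]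
        rfl)
      (fun y v v' => by rw [map_add, map_add, neg_add])
      (fun c y v => by rw [map_smul, map_smul, smul_neg]))
  simp only [LinearMap.mk₂_apply] at hP
  have hw : ∀ X, θ X = 0 → ∀ Y, nuBil p q ((w₀ + P ∘ₗ θ) X) (θ Y) = a ⁅X, Y⁆ := by
    intro X h Y
    rw [LinearMap.add_apply, LinearMap.comp_apply, h, map_zero, add_zero, hw₀' X h]
  have hNor : ∀ Y v,
      LinearMap.trace ℝ _ ((curvCo (nuBil p q) θ a S (w₀ + P ∘ₗ θ) Y ∘ₗ s).flip v) = 0 := by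
    intro Y v
    have h1 := hCo (Y - s (θ Y)) (by rw [map_sub, hs, sub_self])
    rw [map_sub, sub_eq_zero] at h1
    rw [ricOp_change (nuBil_comm p q) s hs, map_add, hP, h1, add_neg_cancel]
  have hA := fun X h Y => (hker _ hw X h Y).1
  have hSS := fun X h Y => (hker _ hw X h Y).2
  exact hasNormalConnection_of_components a S (w₀ + P ∘ₗ θ) s hs hS hX hA hSS
    (fun X h => curvW_eq_zero_of_ker s hs hn hS hX hA hSS hNor h) hNor

end HigherDimension

/-! ### Lie's theorem on the line. -/

section LieLine

variable {F L : Type*} [Field F] [LieRing L] [LieAlgebra F L]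

/-- The Taylor series along `X` of the vector field on the line `L ⧸ ker η` given by an element of
`L`. -/
noncomputable def taylorSeries (η : L →ₗ[F] F) (X Y : L) : PowerSeries F :=
  PowerSeries.mk fun n => η ((LieAlgebra.ad F L X ^ n) Y) / (n.factorial : F)

theorem coeff_taylorSeries (η : L →ₗ[F] F) (X Y : L) (n : ℕ) :
    PowerSeries.coeff n (taylorSeries η X Y) =
      η ((LieAlgebra.ad F L X ^ n) Y) / (n.factorial : F) := PowerSeries.coeff_mk _ _

theorem derivative_taylorSeries [CharZero F] (η : L →ₗ[F] F) (X Y : L) :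
    PowerSeries.derivative F (taylorSeries η X Y) = taylorSeries η X ⁅X, Y⁆ := by
  ext n
  rw [PowerSeries.coeff_derivative, coeff_taylorSeries, coeff_taylorSeries, pow_succ,
    Module.End.mul_apply, LieAlgebra.ad_apply, Nat.factorial_succ, Nat.cast_mul, Nat.cast_succ]
  have h1 : (n.factorial : F) ≠ 0 := Nat.cast_ne_zero.2 n.factorial_ne_zero
  have h2 : (n : F) + 1 ≠ 0 := Nat.cast_add_one_ne_zero n
  field_simp

theorem map_lie_of_ker {η : L →ₗ[F] F} (hη : ∀ Y Z, η Y = 0 → η Z = 0 → η ⁅Y, Z⁆ = 0) {X : L}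
    (hX : η X = 1) (Y Z : L) : η ⁅Y, Z⁆ = η Y * η ⁅X, Z⁆ - η ⁅X, Y⁆ * η Z := by
  have h := hη (Y - η Y • X) (Z - η Z • X) (by simp [hX]) (by simp [hX])
  simp only [lie_sub, sub_lie, lie_smul, smul_lie, map_sub, map_smul, lie_self, smul_eq_mul,
    smul_zero, sub_zero] at h
  rw [← lie_skew Y X, map_neg] at h
  linear_combination h

variable [CharZero F]

/-- Differentiating the series is applying `ad X`, which is a derivation of the bracket, just as
differentiation satisfies the product rule for the Wronskian. So coefficient `n + 1` follows from
coefficient `n`, and the constant term is `map_lie_of_ker`. -/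
theorem taylorSeries_lie {η : L →ₗ[F] F} (hη : ∀ Y Z, η Y = 0 → η Z = 0 → η ⁅Y, Z⁆ = 0) {X : L}
    (hX : η X = 1) (Y Z : L) : taylorSeries η X ⁅Y, Z⁆ =
      taylorSeries η X Y * PowerSeries.derivative F (taylorSeries η X Z) -
        PowerSeries.derivative F (taylorSeries η X Y) * taylorSeries η X Z := by
  ext n
  induction n generalizing Y Z with
  | zero =>
    have := map_lie_of_ker hη hX Y Z
    have hc : ∀ Y, PowerSeries.constantCoeff (taylorSeries η X Y) = η Y := fun Y => by
      rw [← PowerSeries.coeff_zero_eq_constantCoeff_apply, coeff_taylorSeries]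
      simp
    simpa [derivative_taylorSeries, hc] using this
  | succ n ih =>
    have key : ∀ f g : PowerSeries F,
        PowerSeries.coeff n (PowerSeries.derivative F f) =
          PowerSeries.coeff n (PowerSeries.derivative F g) →
        PowerSeries.coeff (n + 1) f = PowerSeries.coeff (n + 1) g := by
      intro f g h
      rw [PowerSeries.coeff_derivative, PowerSeries.coeff_derivative] at h
      exact mul_right_cancel₀ (Nat.cast_add_one_ne_zero n) h
    apply key
    rw [derivative_taylorSeries, leibniz_lie]
    have hadd : ∀ Y Z, taylorSeries η X (Y + Z) = taylorSeries η X Y + taylorSeries η X Z := by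
      intro Y Z
      ext m
      simp [coeff_taylorSeries, add_div]
    rw [hadd, map_add, ih, ih, ← map_add]
    congr 1
    simp only [map_sub, Derivation.leibniz, smul_eq_mul, derivative_taylorSeries]
    ring

/-- `L` contains a vector field vanishing to order exactly `N` at the base point. -/
def HasOrder (η : L →ₗ[F] F) (X : L) (N : ℕ) : Prop :=
  ∃ Y v, taylorSeries η X Y = PowerSeries.X ^ N * v ∧ PowerSeries.constantCoeff v ≠ 0

/-- Bracketing with `X` differentiates the series and, in characteristic zero, lowers a positive
order by exactly one. -/
theorem HasOrder.pred {η : L →ₗ[F] F} {X : L} {N : ℕ} (h : HasOrder η X (N + 1)) :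
    HasOrder η X N := by
  obtain ⟨Y, v, hv, hv0⟩ := h
  refine ⟨⁅X, Y⁆, ((N : PowerSeries F) + 1) * v + PowerSeries.X * PowerSeries.derivative F v, ?_, ?_⟩
  · rw [← derivative_taylorSeries, hv, Derivation.leibniz, Derivation.leibniz_pow]
    simp
    ring
  · simpa using ⟨Nat.cast_add_one_ne_zero N, hv0⟩

theorem HasOrder.mono {η : L →ₗ[F] F} {X : L} {M N : ℕ} (h : HasOrder η X N) (hMN : M ≤ N) :
    HasOrder η X M := by
  induction N, hMN using Nat.le_induction with
  | base => exact h
  | succ N _ ih => exact ih h.pred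

/-- The bracket of fields of orders `2` and `N` has leading coefficient `N - 2` times the product of
the leading coefficients, in degree `N + 1`. It does not vanish for `N ≥ 3`. -/
theorem HasOrder.succ {η : L →ₗ[F] F} (hη : ∀ Y Z, η Y = 0 → η Z = 0 → η ⁅Y, Z⁆ = 0) {X : L}
    (hX : η X = 1) {N : ℕ} (hN : 3 ≤ N) (h : HasOrder η X N) : HasOrder η X (N + 1) := by
  obtain ⟨Z, u, hu, hu0⟩ := h.mono (show 2 ≤ N by omega)
  obtain ⟨Y, v, hv, hv0⟩ := h
  obtain ⟨M, rfl⟩ : ∃ M, N = M + 3 := ⟨N - 3, by omega⟩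
  refine ⟨⁅Z, Y⁆, ((M : PowerSeries F) + 1) * u * v + PowerSeries.X *
    (u * PowerSeries.derivative F v - PowerSeries.derivative F u * v), ?_, ?_⟩
  · rw [taylorSeries_lie hη hX, hu, hv]
    simp only [Derivation.leibniz, Derivation.leibniz_pow, PowerSeries.derivative_X, smul_eq_mul]
    simp
    ring
  · simpa using ⟨⟨Nat.cast_add_one_ne_zero M, hu0⟩, hv0⟩

/-- A field of order three would generate fields of every order. But the subspaces of elements whose
first `n` Taylor coefficients vanish form a decreasing chain, which becomes stationary in finite
dimension. -/
theorem not_hasOrder_three [FiniteDimensional F L] {η : L →ₗ[F] F}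
    (hη : ∀ Y Z, η Y = 0 → η Z = 0 → η ⁅Y, Z⁆ = 0) {X : L} (hX : η X = 1) :
    ¬HasOrder η X 3 := by
  intro h3
  have hall : ∀ N, HasOrder η X N := by
    intro N
    rcases le_total N 3 with hN | hN
    · exact h3.mono hN
    · induction N, hN using Nat.le_induction with
      | base => exact h3
      | succ N hN ih => exact ih.succ hη hX hN
  let K : ℕ →o (Submodule F L)ᵒᵈ :=
    { toFun n := OrderDual.toDual (⨅ i ∈ Finset.range n, LinearMap.ker (η ∘ₗ
        LieAlgebra.ad F L X ^ i))
      monotone' m n hmn := by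
        apply OrderDual.toDual_le_toDual.2
        exact biInf_mono fun i hi => Finset.mem_range.2 ((Finset.mem_range.1 hi).trans_le hmn) }
  obtain ⟨n, hn⟩ := IsArtinian.monotone_stabilizes K
  obtain ⟨Y, v, hv, hv0⟩ := hall n
  have hY : ∀ i, η ((LieAlgebra.ad F L X ^ i) Y) / (i.factorial : F) =
      PowerSeries.coeff i (PowerSeries.X ^ n * v) := fun i => by
    rw [← hv, coeff_taylorSeries]
  have h1 : Y ∈ OrderDual.ofDual (K n) := by
    simp only [K, OrderHom.coe_mk, OrderDual.ofDual_toDual, Submodule.mem_iInf, Finset.mem_range]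
    intro i hi
    have := hY i
    rw [PowerSeries.coeff_X_pow_mul', if_neg (by omega), div_eq_zero_iff] at this
    exact this.resolve_right (Nat.cast_ne_zero.2 i.factorial_ne_zero)
  rw [hn (n + 1) (Nat.le_succ n)] at h1
  simp only [K, OrderHom.coe_mk, OrderDual.ofDual_toDual, Submodule.mem_iInf, Finset.mem_range] at h1
  have h2 : η ((LieAlgebra.ad F L X ^ n) Y) = 0 := h1 n (Nat.lt_succ_self n)
  have h3 := hY n
  rw [h2, zero_div, PowerSeries.coeff_X_pow_mul', if_pos le_rfl, Nat.sub_self] at h3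
  exact hv0 (by simpa using h3.symm)

/-- The third order part of a finite-dimensional Lie algebra of vector fields on the line depends
on the lower order parts. -/
theorem exists_third_order_relation [FiniteDimensional F L] {η : L →ₗ[F] F}
    (hη : ∀ Y Z, η Y = 0 → η Z = 0 → η ⁅Y, Z⁆ = 0) {X : L} (hX : η X = 1) :
    ∃ c₁ c₂ : F, ∀ Y, η ⁅X, ⁅X, ⁅X, Y⁆⁆⁆ = c₁ * η ⁅X, Y⁆ + c₂ * η ⁅X, ⁅X, Y⁆⁆ := by
  let D := LieAlgebra.ad F L X
  have hker : ∀ Y, η Y = 0 → η ⁅X, Y⁆ = 0 → η ⁅X, ⁅X, Y⁆⁆ = 0 → η ⁅X, ⁅X, ⁅X, Y⁆⁆⁆ = 0 := by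
    intro Y h0 h1 h2
    by_contra h3
    refine not_hasOrder_three hη hX ⟨Y, PowerSeries.mk fun i =>
      PowerSeries.coeff (i + 3) (taylorSeries η X Y), ?_, ?_⟩
    · ext n
      rw [PowerSeries.coeff_X_pow_mul']
      split_ifs with hn
      · rw [PowerSeries.coeff_mk, Nat.sub_add_cancel hn]
      · rw [coeff_taylorSeries]
        obtain rfl | rfl | rfl : n = 0 ∨ n = 1 ∨ n = 2 := by omega
        · simp [h0]
        · simp [h1]
        · simp [pow_two, h2]
    · rw [← PowerSeries.coeff_zero_eq_constantCoeff_apply, PowerSeries.coeff_mk,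
        coeff_taylorSeries, div_ne_zero_iff]
      refine ⟨?_, Nat.cast_ne_zero.2 (Nat.factorial_ne_zero _)⟩
      simpa [pow_succ] using h3
  have hspan := mem_span_of_iInf_ker_le_ker (𝕜 := F)
    (L := ![η, η ∘ₗ D, η ∘ₗ D ∘ₗ D]) (K := η ∘ₗ D ∘ₗ D ∘ₗ D) (by
      intro Y hY
      simp only [Submodule.mem_iInf, Fin.forall_fin_succ] at hY
      simp at hY
      exact hker Y hY.1 hY.2.1 hY.2.2)
  rw [Submodule.mem_span_range_iff_exists_fun] at hspan
  obtain ⟨c, hc⟩ := hspan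
  have hc' : ∀ Y, η ⁅X, ⁅X, ⁅X, Y⁆⁆⁆ = c 0 * η Y + c 1 * η ⁅X, Y⁆ + c 2 * η ⁅X, ⁅X, Y⁆⁆ := by
    intro Y
    have := LinearMap.congr_fun hc Y
    simp only [Fin.sum_univ_three] at this
    simpa [D] using this.symm
  -- At `Y = X` all brackets vanish and `η X = 1`, so the coefficient of `η Y` is zero.
  have hc0 := hc' X
  simp [hX] at hc0
  refine ⟨c 1, c 2, fun Y => ?_⟩
  rw [hc', ← hc0]
  ring

/-- Lie's theorem on the line: a pair of a finite-dimensional Lie algebra and a subalgebra of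
codimension one maps to `𝔰𝔩₂`. The homomorphism is given in components. -/
theorem exists_sl_two_components [FiniteDimensional F L] (η : L →ₗ[F] F)
    (hη : ∀ Y Z, η Y = 0 → η Z = 0 → η ⁅Y, Z⁆ = 0) :
    ∃ η₁ η₂ : L →ₗ[F] F, (∀ Y Z, η ⁅Y, Z⁆ = η Y * η₁ Z - η₁ Y * η Z) ∧
      (∀ Y Z, η₁ ⁅Y, Z⁆ = η Y * η₂ Z - η₂ Y * η Z) ∧
      ∀ Y Z, η₂ ⁅Y, Z⁆ = η₁ Y * η₂ Z - η₂ Y * η₁ Z := by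
  by_cases h0 : η = 0
  · exact ⟨0, 0, by simp [h0], by simp [h0], by simp⟩
  obtain ⟨X₀, hX₀⟩ : ∃ X, η X ≠ 0 := by
    by_contra! h
    exact h0 (LinearMap.ext h)
  obtain ⟨X, hX⟩ : ∃ X, η X = 1 := ⟨(η X₀)⁻¹ • X₀, by simp [hX₀]⟩
  have e0 := map_lie_of_ker hη hX
  have e1 : ∀ Y Z, η ⁅X, ⁅Y, Z⁆⁆ = η Y * η ⁅X, ⁅X, Z⁆⁆ - η ⁅X, ⁅X, Y⁆⁆ * η Z := by
    intro Y Z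
    rw [leibniz_lie, map_add, e0 ⁅X, Y⁆, e0 Y]
    ring
  have e2 : ∀ Y Z, η ⁅X, ⁅X, ⁅Y, Z⁆⁆⁆ = η Y * η ⁅X, ⁅X, ⁅X, Z⁆⁆⁆ - η ⁅X, ⁅X, ⁅X, Y⁆⁆⁆ * η Z
      + η ⁅X, Y⁆ * η ⁅X, ⁅X, Z⁆⁆ - η ⁅X, ⁅X, Y⁆⁆ * η ⁅X, Z⁆ := by
    intro Y Z
    rw [leibniz_lie X Y Z, lie_add, map_add, e1 ⁅X, Y⁆, e1 Y]
    ring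
  obtain ⟨μ, hμ⟩ : ∃ μ : F, ∀ Y, η ⁅X, ⁅X, ⁅X, Y⁆⁆⁆ = μ * η ⁅X, Y⁆ := by
    obtain ⟨c₁, c₂, hc⟩ := exists_third_order_relation hη hX
    by_cases hc₂ : c₂ = 0
    · exact ⟨c₁, fun Y => by rw [hc, hc₂, zero_mul, add_zero]⟩
    -- If `c₂ ≠ 0`, applying the third order relation to a bracket forces the first and second order
    -- parts to be proportional. The third order part is then a constant multiple of the first, the
    -- constant being the square of the ratio.
    have hw : ∀ Y Z, η ⁅X, Y⁆ * η ⁅X, ⁅X, Z⁆⁆ = η ⁅X, ⁅X, Y⁆⁆ * η ⁅X, Z⁆ := by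
      intro Y Z
      have h1 := hc ⁅Y, Z⁆
      rw [e1 Y Z, e2 Y Z, leibniz_lie X Y Z, lie_add, lie_add, map_add, e2 ⁅X, Y⁆,
        e2 Y ⁅X, Z⁆] at h1
      simp only [hc] at h1
      have h3 : c₂ * (η ⁅X, Y⁆ * η ⁅X, ⁅X, Z⁆⁆ - η ⁅X, ⁅X, Y⁆⁆ * η ⁅X, Z⁆) = 0 := by
        linear_combination h1
      exact sub_eq_zero.1 ((mul_eq_zero.1 h3).resolve_left hc₂)
    by_cases hb : ∀ Y, η ⁅X, Y⁆ = 0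
    · exact ⟨0, fun Y => by rw [hb, zero_mul]⟩
    push Not at hb
    obtain ⟨Y, hY⟩ := hb
    have hk : ∀ Z, η ⁅X, ⁅X, Z⁆⁆ = η ⁅X, ⁅X, Y⁆⁆ / η ⁅X, Y⁆ * η ⁅X, Z⁆ := by
      intro Z
      have := hw Y Z
      field_simp
      linear_combination this
    exact ⟨(η ⁅X, ⁅X, Y⁆⁆ / η ⁅X, Y⁆) ^ 2, fun Z => by rw [hk ⁅X, Z⁆, hk Z]; ring⟩
  let D := LieAlgebra.ad F L X
  -- The shift by `μ / 2` absorbs the third order terms `μ η [X, ·]` into the `𝔰𝔩₂` relations. It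
  -- does not disturb the second relation, where its contributions cancel.
  refine ⟨η ∘ₗ D, η ∘ₗ D ∘ₗ D - (μ / 2) • η, e0, fun Y Z => ?_, fun Y Z => ?_⟩
  · simp only [LinearMap.comp_apply, LinearMap.sub_apply, LinearMap.smul_apply, smul_eq_mul, D,
      LieAlgebra.ad_apply, e1 Y Z]
    ring
  · simp only [LinearMap.comp_apply, LinearMap.sub_apply, LinearMap.smul_apply, smul_eq_mul, D,
      LieAlgebra.ad_apply, e2 Y Z, e0 Y Z, hμ]
    ring

end LieLine

/-! ### Flat connections in dimension zero, one, and signature `(1,1)`. -/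

section LowDimension

theorem hasNormalConnection_of_flat {p q : ℕ} {L : Type*} [LieRing L] [LieAlgebra ℝ L]
    {θ : L →ₗ[ℝ] MidIdx p q → ℝ} (s : (MidIdx p q → ℝ) →ₗ[ℝ] L) (hs : ∀ v, θ (s v) = v)
    {a : L →ₗ[ℝ] ℝ} {S : L →ₗ[ℝ] (MidIdx p q → ℝ) →ₗ[ℝ] MidIdx p q → ℝ}
    {w : L →ₗ[ℝ] MidIdx p q → ℝ} (hS : ∀ X u v, nuBil p q (S X u) v = -nuBil p q u (S X v))
    (hX : ∀ X Y, curvX θ a S X Y = 0) (hA : ∀ X Y, curvA (nuBil p q) θ a w X Y = 0)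
    (hSS : ∀ X Y, curvS (nuBil p q) θ S w X Y = 0) (hW : ∀ X Y, curvW a S w X Y = 0) :
    HasNormalConnection θ := by
  refine hasNormalConnection_of_components a S w s hs hS hX (fun X _ => hA X) (fun X _ => hSS X)
    (fun X _ => hW X) fun Y v => ?_
  have h : curvCo (nuBil p q) θ a S w Y = 0 := by
    refine LinearMap.ext fun X => LinearMap.ext fun v => ?_
    rw [curvCo_apply, hA, hSS]
    simp
  rw [h]
  exact map_zero _

variable {L : Type*} [LieRing L] [LieAlgebra ℝ L]

theorem hasNormalConnection_zero {θ : L →ₗ[ℝ] MidIdx 0 0 → ℝ} (s : (MidIdx 0 0 → ℝ) →ₗ[ℝ] L)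
    (hs : ∀ v, θ (s v) = v) : HasNormalConnection θ := by
  have : IsEmpty (MidIdx 0 0) := inferInstanceAs (IsEmpty (Fin 0 ⊕ (Fin 0 ⊕ Fin 0)))
  refine hasNormalConnection_of_flat (a := 0) (S := 0) (w := 0) s hs (by simp)
    (fun X Y => Subsingleton.elim _ _) (by simp [curvA])
    (fun X Y => LinearMap.ext fun v => Subsingleton.elim _ _) fun X Y => Subsingleton.elim _ _

theorem nuBil_zero_one (x y : MidIdx 0 1 → ℝ) :
    nuBil 0 1 x y = x (Sum.inr (Sum.inl 0)) * y (Sum.inr (Sum.inl 0)) := by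
  have h : (Finset.univ : Finset (MidIdx 0 1)) = {Sum.inr (Sum.inl 0)} := by decide
  simp [nuBil_apply, dotProduct, mulVec, h, nuMatrix]

theorem nuBil_one_one (x y : MidIdx 1 1 → ℝ) : nuBil 1 1 x y =
    x (Sum.inl 0) * y (Sum.inr (Sum.inr 0)) + x (Sum.inr (Sum.inr 0)) * y (Sum.inl 0) := by
  have h : (Finset.univ : Finset (MidIdx 1 1)) = {Sum.inl 0, Sum.inr (Sum.inr 0)} := by decide
  simp [nuBil_apply, dotProduct, mulVec, h, nuMatrix]

theorem nuBil_zero_two (x y : MidIdx 0 2 → ℝ) : nuBil 0 2 x y =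
    x (Sum.inr (Sum.inl 0)) * y (Sum.inr (Sum.inl 0)) +
      x (Sum.inr (Sum.inl 1)) * y (Sum.inr (Sum.inl 1)) := by
  have h : (Finset.univ : Finset (MidIdx 0 2)) = {Sum.inr (Sum.inl 0), Sum.inr (Sum.inl 1)} := by
    decide
  simp [nuBil_apply, dotProduct, mulVec, h, nuMatrix, one_apply]

theorem ext_zero_one {x y : MidIdx 0 1 → ℝ}
    (h : x (Sum.inr (Sum.inl 0)) = y (Sum.inr (Sum.inl 0))) : x = y := by
  have : ∀ i : MidIdx 0 1, i = Sum.inr (Sum.inl 0) := by decide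
  funext i
  rw [this i, h]

theorem ext_one_one {x y : MidIdx 1 1 → ℝ} (h : x (Sum.inl 0) = y (Sum.inl 0))
    (h' : x (Sum.inr (Sum.inr 0)) = y (Sum.inr (Sum.inr 0))) : x = y := by
  have : ∀ i : MidIdx 1 1, i = Sum.inl 0 ∨ i = Sum.inr (Sum.inr 0) := by decide
  funext i
  rcases this i with rfl | rfl <;> assumption

theorem ext_zero_two {x y : MidIdx 0 2 → ℝ}
    (h : x (Sum.inr (Sum.inl 0)) = y (Sum.inr (Sum.inl 0)))
    (h' : x (Sum.inr (Sum.inl 1)) = y (Sum.inr (Sum.inl 1))) : x = y := by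
  have : ∀ i : MidIdx 0 2, i = Sum.inr (Sum.inl 0) ∨ i = Sum.inr (Sum.inl 1) := by decide
  funext i
  rcases this i with rfl | rfl <;> assumption

theorem hasNormalConnection_zero_one [FiniteDimensional ℝ L] {θ : L →ₗ[ℝ] MidIdx 0 1 → ℝ}
    (s : (MidIdx 0 1 → ℝ) →ₗ[ℝ] L) (hs : ∀ v, θ (s v) = v) {a : L →ₗ[ℝ] ℝ}
    {S : L →ₗ[ℝ] (MidIdx 0 1 → ℝ) →ₗ[ℝ] MidIdx 0 1 → ℝ}
    (hX : ∀ X Y, curvX θ a S X Y = 0) : HasNormalConnection θ := by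
  obtain ⟨η₁, η₂, h0, h1, h2⟩ := exists_sl_two_components
    (LinearMap.proj (Sum.inr (Sum.inl 0)) ∘ₗ θ) (fun Y Z hY hZ => by
      have hY' : θ Y = 0 := ext_zero_one hY
      have hZ' : θ Z = 0 := ext_zero_one hZ
      rw [LinearMap.comp_apply, map_lie_of_torsionFree_of_ker hX hY', hZ']
      simp)
  simp only [LinearMap.comp_apply, LinearMap.proj_apply] at h0 h1 h2
  refine hasNormalConnection_of_flat (a := η₁) (S := 0) (w := LinearMap.pi fun _ => -η₂) s hs
    (by simp) (fun X Y => ext_zero_one ?_) (fun X Y => ?_)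
    (fun X Y => LinearMap.ext fun v => ext_zero_one ?_) (fun X Y => ext_zero_one ?_)
  · simp [curvX, h0]
    ring
  · simp [curvA, nuBil_zero_one, h1]
    ring
  · simp [curvS, nuBil_zero_one]
    ring
  · simp [curvW, h2]
    ring

/-- The endomorphism `diag(1, -1)`. -/
noncomputable def splitRotation : (MidIdx 1 1 → ℝ) →ₗ[ℝ] MidIdx 1 1 → ℝ :=
  LinearMap.pi (Sum.elim (fun _ => LinearMap.proj (Sum.inl 0))
    fun _ => -LinearMap.proj (Sum.inr (Sum.inr 0)))

/-- Skew maps preserve both null lines, so the kernel of each null coordinate of `θ` is a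
subalgebra. Lie's theorem for each coordinate gives the two factors of `𝔰𝔬(2,2) = 𝔰𝔩₂ ⊕ 𝔰𝔩₂`. -/
theorem hasNormalConnection_one_one [FiniteDimensional ℝ L] {θ : L →ₗ[ℝ] MidIdx 1 1 → ℝ}
    (s : (MidIdx 1 1 → ℝ) →ₗ[ℝ] L) (hs : ∀ v, θ (s v) = v) {a : L →ₗ[ℝ] ℝ}
    {S : L →ₗ[ℝ] (MidIdx 1 1 → ℝ) →ₗ[ℝ] MidIdx 1 1 → ℝ}
    (hS : ∀ X u v, nuBil 1 1 (S X u) v = -nuBil 1 1 u (S X v))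
    (hX : ∀ X Y, curvX θ a S X Y = 0) : HasNormalConnection θ := by
  have hS' : ∀ X v, S X v (Sum.inl 0) * v (Sum.inr (Sum.inr 0)) +
      S X v (Sum.inr (Sum.inr 0)) * v (Sum.inl 0) = 0 := fun X v => by
    have := hS X v v
    rw [nuBil_one_one, nuBil_one_one] at this
    linarith
  obtain ⟨η₁, η₂, h0, h1, h2⟩ := exists_sl_two_components
    (LinearMap.proj (Sum.inl 0) ∘ₗ θ) (by
      have key : ∀ X v, v (Sum.inl 0) = 0 → S X v (Sum.inl 0) = 0 := fun X v hv => by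
        have := hS' X v
        rw [hv, mul_zero, add_zero] at this
        rcases mul_eq_zero.1 this with h | h
        · exact h
        · have hv0 : v = 0 := ext_one_one hv h
          rw [hv0]
          simp
      intro Y Z hY hZ
      simp only [LinearMap.comp_apply, LinearMap.proj_apply] at hY hZ ⊢
      rw [map_lie_of_torsionFree hX]
      simp [key _ _ hY, key _ _ hZ, hY, hZ])
  obtain ⟨ζ₁, ζ₂, k0, k1, k2⟩ := exists_sl_two_components
    (LinearMap.proj (Sum.inr (Sum.inr 0)) ∘ₗ θ) (by
      have key : ∀ X v, v (Sum.inr (Sum.inr 0)) = 0 → S X v (Sum.inr (Sum.inr 0)) = 0 :=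
        fun X v hv => by
        have := hS' X v
        rw [hv, mul_zero, zero_add] at this
        rcases mul_eq_zero.1 this with h | h
        · exact h
        · have hv0 : v = 0 := ext_one_one h hv
          rw [hv0]
          simp
      intro Y Z hY hZ
      simp only [LinearMap.comp_apply, LinearMap.proj_apply] at hY hZ ⊢
      rw [map_lie_of_torsionFree hX]
      simp [key _ _ hY, key _ _ hZ, hY, hZ])
  simp only [LinearMap.comp_apply, LinearMap.proj_apply] at h0 h1 h2 k0 k1 k2
  -- These values make `S - a` equal to `diag(-η₁, -ζ₁)`. The components of `w` are interchanged
  -- because `ν` pairs one null coordinate with the other.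
  refine hasNormalConnection_of_flat (a := (1 / 2 : ℝ) • (η₁ + ζ₁))
    (S := LinearMap.toSpanSingleton ℝ _ splitRotation ∘ₗ ((1 / 2 : ℝ) • (ζ₁ - η₁)))
    (w := LinearMap.pi (Sum.elim (fun _ => (-1 / 2 : ℝ) • ζ₂) fun _ => (-1 / 2 : ℝ) • η₂)) s hs
    (fun X u v => ?_) (fun X Y => ext_one_one ?_ ?_) (fun X Y => ?_)
    (fun X Y => LinearMap.ext fun v => ext_one_one ?_ ?_) (fun X Y => ext_one_one ?_ ?_)
  · simp [nuBil_one_one, splitRotation]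
    ring
  · simp [curvX, splitRotation, h0]
    ring
  · simp [curvX, splitRotation, k0]
    ring
  · simp [curvA, nuBil_one_one, h1, k1]
    ring
  · simp [curvS, nuBil_one_one, splitRotation, h1, k1]
    ring
  · simp [curvS, nuBil_one_one, splitRotation, h1, k1]
    ring
  · simp [curvW, splitRotation, k2]
    ring
  · simp [curvW, splitRotation, h2]
    ring

end LowDimension

/-! ### The definite plane and `𝔰𝔩₂(ℂ)`. -/

section Complex

open TensorProduct in
/-- Lie's theorem on the complex line, for a real Lie algebra. -/
theorem exists_sl_two_components_complex {L : Type*} [LieRing L] [LieAlgebra ℝ L]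
    [FiniteDimensional ℝ L] (η μ : L →ₗ[ℝ] ℂ) (hη : ∀ Y Z, η ⁅Y, Z⁆ = μ Y * η Z - μ Z * η Y) :
    ∃ η₁ η₂ : L →ₗ[ℝ] ℂ, (∀ Y Z, η ⁅Y, Z⁆ = η Y * η₁ Z - η₁ Y * η Z) ∧
      (∀ Y Z, η₁ ⁅Y, Z⁆ = η Y * η₂ Z - η₂ Y * η Z) ∧
      ∀ Y Z, η₂ ⁅Y, Z⁆ = η₁ Y * η₂ Z - η₂ Y * η₁ Z := by
  have lie_zero' : ∀ A : ℂ ⊗[ℝ] L, ⁅A, (0 : ℂ ⊗[ℝ] L)⁆ = 0 := fun A => lie_zero A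
  have lie_add' : ∀ A B B' : ℂ ⊗[ℝ] L, ⁅A, B + B'⁆ = ⁅A, B⁆ + ⁅A, B'⁆ := fun A B B' =>
    lie_add A B B'
  -- The relation with `μ` is bilinear, so it survives complexification, and it makes the kernel of
  -- the complex-linear extension of `η` a subalgebra.
  have key : ∀ A B : ℂ ⊗[ℝ] L, η.liftBaseChange ℂ ⁅A, B⁆ =
      μ.liftBaseChange ℂ A * η.liftBaseChange ℂ B -
        μ.liftBaseChange ℂ B * η.liftBaseChange ℂ A := by
    intro A B
    induction A using TensorProduct.induction_on with
    | zero => simp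
    | add A A' hA hA' =>
      rw [add_lie, map_add, hA, hA', map_add, map_add]
      ring
    | tmul z Y =>
      induction B using TensorProduct.induction_on with
      | zero => simp [lie_zero']
      | add B B' hB hB' =>
        rw [lie_add', map_add, hB, hB', map_add, map_add]
        ring
      | tmul z' Y' =>
        simp only [LieAlgebra.ExtendScalars.bracket_tmul, LinearMap.liftBaseChange_tmul, hη,
          smul_eq_mul]
        ring
  obtain ⟨η₁, η₂, h0, h1, h2⟩ := exists_sl_two_components (η.liftBaseChange ℂ) (fun A B hA hB => by
    rw [key, hA, hB]
    ring)
  let ι : L →ₗ[ℝ] ℂ ⊗[ℝ] L := TensorProduct.mk ℝ ℂ L 1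
  have hι : ∀ Y Z, ι ⁅Y, Z⁆ = ⁅ι Y, ι Z⁆ := fun Y Z => by
    simp [ι]
  have hηι : ∀ Y, η.liftBaseChange ℂ (ι Y) = η Y := fun Y => by
    simp [ι]
  refine ⟨η₁.restrictScalars ℝ ∘ₗ ι, η₂.restrictScalars ℝ ∘ₗ ι, fun Y Z => ?_, fun Y Z => ?_,
    fun Y Z => ?_⟩
  · rw [← hηι, hι, h0, hηι, hηι]
    rfl
  · simp only [LinearMap.comp_apply, LinearMap.restrictScalars_apply]
    rw [hι, h1, hηι, hηι]
  · simp only [LinearMap.comp_apply, LinearMap.restrictScalars_apply]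
    rw [hι, h2]

/-- The rotation by a right angle. -/
def rightRotation : (MidIdx 0 2 → ℝ) →ₗ[ℝ] MidIdx 0 2 → ℝ where
  toFun v i := if i = Sum.inr (Sum.inl 0) then -v (Sum.inr (Sum.inl 1)) else v (Sum.inr (Sum.inl 0))
  map_add' u v := by
    ext i
    simp only [Pi.add_apply]
    split_ifs <;> ring
  map_smul' c v := by
    ext i
    simp only [Pi.smul_apply, smul_eq_mul, RingHom.id_apply]
    split_ifs <;> ring

theorem rightRotation_apply_zero (v : MidIdx 0 2 → ℝ) :
    rightRotation v (Sum.inr (Sum.inl 0)) = -v (Sum.inr (Sum.inl 1)) := by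
  simp [rightRotation]

theorem rightRotation_apply_one (v : MidIdx 0 2 → ℝ) :
    rightRotation v (Sum.inr (Sum.inl 1)) = v (Sum.inr (Sum.inl 0)) := by
  simp [rightRotation]

theorem exists_eq_smul_rightRotation {S : (MidIdx 0 2 → ℝ) →ₗ[ℝ] MidIdx 0 2 → ℝ}
    (hS : ∀ u v, nuBil 0 2 (S u) v = -nuBil 0 2 u (S v)) (v : MidIdx 0 2 → ℝ) :
    S v = S (Pi.single (Sum.inr (Sum.inl 0)) 1) (Sum.inr (Sum.inl 1)) • rightRotation v := by
  have hne : (Sum.inr (Sum.inl 1) : MidIdx 0 2) ≠ Sum.inr (Sum.inl 0) := by decide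
  have h0 := hS (Pi.single (Sum.inr (Sum.inl 0)) 1) v
  have h1 := hS (Pi.single (Sum.inr (Sum.inl 0)) 1) (Pi.single (Sum.inr (Sum.inl 0)) 1)
  have h2 := hS v v
  have h3 := hS (Pi.single (Sum.inr (Sum.inl 1)) 1) v
  have h4 := hS (Pi.single (Sum.inr (Sum.inl 1)) 1) (Pi.single (Sum.inr (Sum.inl 1)) 1)
  have h5 := hS (Pi.single (Sum.inr (Sum.inl 1)) 1) (Pi.single (Sum.inr (Sum.inl 0)) 1)
  simp only [nuBil_zero_two, Pi.single_eq_same, Pi.single_eq_of_ne hne,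
    Pi.single_eq_of_ne hne.symm] at h0 h1 h2 h3 h4 h5
  have h1' : S (Pi.single (Sum.inr (Sum.inl 0)) 1) (Sum.inr (Sum.inl 0)) = 0 := by linarith
  have h4' : S (Pi.single (Sum.inr (Sum.inl 1)) 1) (Sum.inr (Sum.inl 1)) = 0 := by linarith
  rw [h1'] at h0
  rw [h4'] at h3
  refine ext_zero_two ?_ ?_
  · rw [Pi.smul_apply, rightRotation_apply_zero, smul_eq_mul]
    linarith
  · rw [Pi.smul_apply, rightRotation_apply_one, smul_eq_mul]
    have h6 : S (Pi.single (Sum.inr (Sum.inl 1)) 1) (Sum.inr (Sum.inl 0)) =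
      -S (Pi.single (Sum.inr (Sum.inl 0)) 1) (Sum.inr (Sum.inl 1)) := by linarith
    rw [h6] at h3
    linarith

/-- On the plane identified with `ℂ`, the conformal algebra is multiplication by complex numbers: `S
- a` multiplies by `μ`. Vanishing torsion is then the hypothesis of Lie's theorem over `ℂ`. -/
theorem hasNormalConnection_zero_two {L : Type*} [LieRing L] [LieAlgebra ℝ L]
    [FiniteDimensional ℝ L] {θ : L →ₗ[ℝ] MidIdx 0 2 → ℝ}
    (s : (MidIdx 0 2 → ℝ) →ₗ[ℝ] L) (hs : ∀ v, θ (s v) = v) {a : L →ₗ[ℝ] ℝ}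
    {S : L →ₗ[ℝ] (MidIdx 0 2 → ℝ) →ₗ[ℝ] MidIdx 0 2 → ℝ}
    (hS : ∀ X u v, nuBil 0 2 (S X u) v = -nuBil 0 2 u (S X v))
    (hX : ∀ X Y, curvX θ a S X Y = 0) : HasNormalConnection θ := by
  let toC : (MidIdx 0 2 → ℝ) →ₗ[ℝ] ℂ :=
    { toFun v := ⟨v (Sum.inr (Sum.inl 0)), v (Sum.inr (Sum.inl 1))⟩
      map_add' u v := rfl
      map_smul' c v := by
        apply Complex.ext <;> simp }
  let μ : L →ₗ[ℝ] ℂ :=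
    { toFun X := ⟨-a X, S X (Pi.single (Sum.inr (Sum.inl 0)) 1) (Sum.inr (Sum.inl 1))⟩
      map_add' X Y := by
        apply Complex.ext <;> simp
        ring
      map_smul' c X := by
        apply Complex.ext <;> simp }
  have hr0 := rightRotation_apply_zero
  have hr1 := rightRotation_apply_one
  obtain ⟨η₁, η₂, h0, h1, h2⟩ := exists_sl_two_components_complex (toC ∘ₗ θ) μ (fun Y Z => by
    rw [LinearMap.comp_apply, map_lie_of_torsionFree hX, exists_eq_smul_rightRotation (hS Y),
      exists_eq_smul_rightRotation (hS Z)]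
    apply Complex.ext <;>
      simp [toC, μ, hr0, hr1] <;> ring)
  have h0r := fun X Y => congrArg Complex.re (h0 X Y)
  have h0i := fun X Y => congrArg Complex.im (h0 X Y)
  have h1r := fun X Y => congrArg Complex.re (h1 X Y)
  have h1i := fun X Y => congrArg Complex.im (h1 X Y)
  have h2r := fun X Y => congrArg Complex.re (h2 X Y)
  have h2i := fun X Y => congrArg Complex.im (h2 X Y)
  simp only [LinearMap.comp_apply, Complex.sub_re, Complex.sub_im, Complex.mul_re,
    Complex.mul_im, toC, LinearMap.coe_mk, AddHom.coe_mk] at h0r h0i h1r h1i h2r h2i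
  let w : L →ₗ[ℝ] MidIdx 0 2 → ℝ :=
    { toFun X i := if i = Sum.inr (Sum.inl 0) then -(η₂ X).re else (η₂ X).im
      map_add' X Y := by
        ext i
        simp only [Pi.add_apply, map_add, Complex.add_re, Complex.add_im]
        split_ifs <;> ring
      map_smul' c X := by
        ext i
        simp only [Pi.smul_apply, map_smul, smul_eq_mul, RingHom.id_apply, Complex.real_smul,
          Complex.mul_re, Complex.mul_im, Complex.ofReal_re, Complex.ofReal_im]
        split_ifs <;> ring }
  have hw0 : ∀ X, w X (Sum.inr (Sum.inl 0)) = -(η₂ X).re := fun X => by simp [w]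
  have hw1 : ∀ X, w X (Sum.inr (Sum.inl 1)) = (η₂ X).im := fun X => by simp [w]
  -- Here `S - a` is multiplication by `-η₁`. The vector `w` is minus the conjugate of `η₂`, so that
  -- its scalar product with `x` is `-Re (η₂ x)`.
  refine hasNormalConnection_of_flat (a := Complex.reLm ∘ₗ η₁)
    (S := LinearMap.toSpanSingleton ℝ _ (-rightRotation) ∘ₗ Complex.imLm ∘ₗ η₁) (w := w) s hs
    (fun X u v => ?_) (fun X Y => ext_zero_two ?_ ?_) (fun X Y => ?_)
    (fun X Y => LinearMap.ext fun v => ext_zero_two ?_ ?_) (fun X Y => ext_zero_two ?_ ?_)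
  · simp [nuBil_zero_two, hr0, hr1]
    ring
  · simp [curvX, hr0, h0r]
    ring
  · simp [curvX, hr1, h0i]
    ring
  · simp [curvA, nuBil_zero_two, h1r, hw0, hw1]
    ring
  · simp [curvS, nuBil_zero_two, hr0, hr1, hw0, hw1, h1i]
    ring
  · simp [curvS, nuBil_zero_two, hr0, hr1, hw0, hw1, h1i]
    ring
  · simp [curvW, hr0, hw0, hw1, h2r]
    ring
  · simp [curvW, hr1, hw0, hw1, h2i]
    ring

end Complex

/-! ### The algebraic theorem in all dimensions. -/

section Isotropy

variable {L : Type*} [LieRing L] [LieAlgebra ℝ L] {p q : ℕ}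

theorem hasNormalConnection_of_isotropy [FiniteDimensional ℝ L] (hpq : p ≤ q)
    {θ : L →ₗ[ℝ] MidIdx p q → ℝ} (hθ : Function.Surjective θ)
    (hiso : ∀ h, θ h = 0 → ∃ c : ℝ, ∀ Y Z,
      nuBil p q (θ ⁅h, Y⁆) (θ Z) + nuBil p q (θ Y) (θ ⁅h, Z⁆) =
        c * nuBil p q (θ Y) (θ Z)) :
    HasNormalConnection θ := by
  obtain ⟨s, hs⟩ := θ.exists_rightInverse_of_surjective (LinearMap.range_eq_top.2 hθ)
  have hs' : ∀ v, θ (s v) = v := fun v => LinearMap.congr_fun hs v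
  have hn : Module.finrank ℝ (MidIdx p q → ℝ) = p + q := by
    simp only [Module.finrank_fintype_fun_eq_card, Fintype.card_sum, Fintype.card_fin]
    omega
  obtain h0 | h0 := Nat.eq_zero_or_pos (p + q)
  · obtain ⟨rfl, rfl⟩ : p = 0 ∧ q = 0 := by omega
    exact hasNormalConnection_zero s hs'
  have : Nontrivial (MidIdx p q → ℝ) := Module.nontrivial_of_finrank_pos (R := ℝ) (by omega)
  obtain ⟨a, S, hS, hX⟩ := exists_torsionFree (nuBil_comm p q) (nuBil_nondegenerate p q)
    s hs' hiso
  by_cases h3 : 3 ≤ p + q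
  · exact hasNormalConnection_of_three_le (by omega) s hs' hS hX
  obtain ⟨rfl, rfl⟩ | ⟨rfl, rfl⟩ | ⟨rfl, rfl⟩ :
      p = 0 ∧ q = 1 ∨ p = 0 ∧ q = 2 ∨ p = 1 ∧ q = 1 := by omega
  · exact hasNormalConnection_zero_one s hs' hX
  · exact hasNormalConnection_zero_two s hs' hS hX
  · exact hasNormalConnection_one_one s hs' hS hX

end Isotropy

/-! ### Derivatives along Lie brackets of vector fields on manifolds. -/

section DirectionalDerivative

open VectorField
open scoped Topology

variable {E F M : Type*} [NormedAddCommGroup E] [NormedSpace ℝ E] [NormedAddCommGroup F]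
  [NormedSpace ℝ F] [TopologicalSpace M] [ChartedSpace E M]

/-- The derivative of a vector-valued function along a vector field. -/
noncomputable def derivAlong (f : M → F) (V : ∀ y : M, TangentSpace 𝓘(ℝ, E) y) (y : M) : F :=
  mfderiv 𝓘(ℝ, E) 𝓘(ℝ, F) f y (V y)

/-- The expression of a vector field in the preferred chart at `x`. -/
noncomputable def chartField (x : M) (V : ∀ y : M, TangentSpace 𝓘(ℝ, E) y) : E → E :=
  mpullbackWithin 𝓘(ℝ, E) 𝓘(ℝ, E) (extChartAt 𝓘(ℝ, E) x).symm V (Set.range 𝓘(ℝ, E))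

theorem mfderiv_eq_fderiv_extChartAt {f : M → F} {x : M}
    (hf : MDifferentiableAt 𝓘(ℝ, E) 𝓘(ℝ, F) f x) :
    mfderiv 𝓘(ℝ, E) 𝓘(ℝ, F) f x =
      fderiv ℝ (f ∘ (extChartAt 𝓘(ℝ, E) x).symm) (extChartAt 𝓘(ℝ, E) x x) := by
  simp only [mfderiv, hf, modelWithCornersSelf_coe, Set.range_id, fderivWithin_univ]
  rfl

variable [IsManifold 𝓘(ℝ, E) 2 M]

theorem derivAlong_eq_fderiv_chartField {f : M → F} {x y : M}
    (hy : y ∈ (extChartAt 𝓘(ℝ, E) x).source) (hf : MDifferentiableAt 𝓘(ℝ, E) 𝓘(ℝ, F) f y)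
    (W : ∀ y : M, TangentSpace 𝓘(ℝ, E) y) :
    derivAlong f W y =
      fderiv ℝ (f ∘ (extChartAt 𝓘(ℝ, E) x).symm) (extChartAt 𝓘(ℝ, E) x y)
        (chartField x W (extChartAt 𝓘(ℝ, E) x y)) := by
  rw [derivAlong, chartField]
  set φ := extChartAt 𝓘(ℝ, E) x with hφ
  have hz : φ y ∈ φ.target := φ.map_source hy
  have hyz : φ.symm (φ y) = y := φ.left_inv hy
  have hB := isInvertible_mfderivWithin_extChartAt_symm (I := 𝓘(ℝ, E)) hz
  have hd := mdifferentiableWithinAt_extChartAt_symm (I := 𝓘(ℝ, E)) hz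
  rw [← mfderiv_eq_fderiv, mpullbackWithin_apply]
  simp only [modelWithCornersSelf_coe, Set.range_id, mfderivWithin_univ] at hB hd ⊢
  rw [mdifferentiableWithinAt_univ] at hd
  rw [← hyz] at hf
  rw [mfderiv_comp _ hf hd]
  change _ = mfderiv 𝓘(ℝ, E) 𝓘(ℝ, F) f (φ.symm (φ y)) (mfderiv 𝓘(ℝ, E) 𝓘(ℝ, E) φ.symm (φ y) _)
  have := hB.self_apply_inverse (W (φ.symm (φ y)))
  rw [hyz] at this ⊢
  rw [this]

theorem chartField_self (x : M) (V : ∀ y : M, TangentSpace 𝓘(ℝ, E) y) :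
    chartField x V (extChartAt 𝓘(ℝ, E) x x) = V x := by
  rw [chartField, mpullbackWithin_apply]
  have := mfderivWithin_extChartAt_symm_inverse_apply (I := 𝓘(ℝ, E)) (x := x) (V x)
  rw [extChartAt_to_inv x]
  exact this

theorem mlieBracket_eq_lieBracket_chartField (x : M) (V W : ∀ y : M, TangentSpace 𝓘(ℝ, E) y) :
    mlieBracket 𝓘(ℝ, E) V W x =
      lieBracket ℝ (chartField x V) (chartField x W) (extChartAt 𝓘(ℝ, E) x x) := by
  have key : ∀ (s : Set E) (A B : E → E) (z : E), s = Set.univ →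
      (ContinuousLinearMap.id ℝ E).inverse (lieBracketWithin ℝ A B s z) =
        lieBracket ℝ A B z := by
    rintro s A B z rfl
    rw [ContinuousLinearMap.inverse_id, lieBracketWithin_univ, ContinuousLinearMap.id_apply]
  rw [← mlieBracketWithin_univ, mlieBracketWithin_apply, mfderiv_extChartAt_self]
  exact key _ (chartField x V) (chartField x W) _ (by simp)

variable [CompleteSpace E]

theorem differentiableAt_chartField {x : M} {W : ∀ y : M, TangentSpace 𝓘(ℝ, E) y}
    (hW : MDifferentiableAt 𝓘(ℝ, E) 𝓘(ℝ, E).tangent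
      (fun y => (⟨y, W y⟩ : TangentBundle 𝓘(ℝ, E) M)) x) :
    DifferentiableAt ℝ (chartField x W) (extChartAt 𝓘(ℝ, E) x x) := by
  have key : ∀ (s : Set E) (A : E → E) (z : E), s = Set.univ →
      DifferentiableWithinAt ℝ A s z → DifferentiableAt ℝ A z := by
    rintro s A z rfl h
    exact differentiableWithinAt_univ.1 h
  exact key _ (chartField x W) _ (by simp) (hW.mdifferentiableWithinAt
    (s := Set.univ)).differentiableWithinAt_mpullbackWithin_vectorField

theorem hasMFDerivAt_derivAlong {f : M → F} {x : M}
    (hf : ContMDiffAt 𝓘(ℝ, E) 𝓘(ℝ, F) 2 f x) {W : ∀ y : M, TangentSpace 𝓘(ℝ, E) y}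
    (hW : MDifferentiableAt 𝓘(ℝ, E) 𝓘(ℝ, E).tangent
      (fun y => (⟨y, W y⟩ : TangentBundle 𝓘(ℝ, E) M)) x) :
    HasMFDerivAt 𝓘(ℝ, E) 𝓘(ℝ, F) (derivAlong f W) x
      (fderiv ℝ (fun z => fderiv ℝ (f ∘ (extChartAt 𝓘(ℝ, E) x).symm) z (chartField x W z))
        (extChartAt 𝓘(ℝ, E) x x)) := by
  have hf2 : ContDiffAt ℝ 2 (f ∘ (extChartAt 𝓘(ℝ, E) x).symm) (extChartAt 𝓘(ℝ, E) x x) := by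
    have := (contMDiffAt_iff.1 hf).2
    rwa [modelWithCornersSelf_coe, Set.range_id, contDiffWithinAt_univ] at this
  have h1 : DifferentiableAt ℝ
      (fun z => fderiv ℝ (f ∘ (extChartAt 𝓘(ℝ, E) x).symm) z (chartField x W z))
      (extChartAt 𝓘(ℝ, E) x x) :=
    ((hf2.fderiv_right (m := 1) (by norm_num)).differentiableAt one_ne_zero).clm_apply
      (differentiableAt_chartField hW)
  have h2 := (mdifferentiableAt_extChartAt (I := 𝓘(ℝ, E)) (mem_chart_source E x)).hasMFDerivAt
  rw [mfderiv_extChartAt_self] at h2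
  refine (h1.hasFDerivAt.hasMFDerivAt.comp x h2).congr_of_eventuallyEq ?_
  filter_upwards [(contMDiffAt_iff_contMDiffAt_nhds (by simp)).1 hf,
    extChartAt_source_mem_nhds (I := 𝓘(ℝ, E)) x] with y hy hy'
  exact derivAlong_eq_fderiv_chartField hy' (hy.mdifferentiableAt two_ne_zero) W

/-- The derivative along a Lie bracket is the commutator of the derivatives along the two
vector fields. -/
theorem exists_hasMFDerivAt_derivAlong {f : M → F} {x : M}
    (hf : ContMDiffAt 𝓘(ℝ, E) 𝓘(ℝ, F) 2 f x) {V W : ∀ y : M, TangentSpace 𝓘(ℝ, E) y}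
    (hV : MDifferentiableAt 𝓘(ℝ, E) 𝓘(ℝ, E).tangent
      (fun y => (⟨y, V y⟩ : TangentBundle 𝓘(ℝ, E) M)) x)
    (hW : MDifferentiableAt 𝓘(ℝ, E) 𝓘(ℝ, E).tangent
      (fun y => (⟨y, W y⟩ : TangentBundle 𝓘(ℝ, E) M)) x) :
    ∃ A B : E →L[ℝ] F,
      HasMFDerivAt 𝓘(ℝ, E) 𝓘(ℝ, F) (derivAlong f V) x A ∧
      HasMFDerivAt 𝓘(ℝ, E) 𝓘(ℝ, F) (derivAlong f W) x B ∧
      derivAlong f (mlieBracket 𝓘(ℝ, E) V W) x = B (V x) - A (W x) := by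
  have hf2 : ContDiffAt ℝ 2 (f ∘ (extChartAt 𝓘(ℝ, E) x).symm) (extChartAt 𝓘(ℝ, E) x x) := by
    have := (contMDiffAt_iff.1 hf).2
    rwa [modelWithCornersSelf_coe, Set.range_id, contDiffWithinAt_univ] at this
  refine ⟨_, _, hasMFDerivAt_derivAlong hf hV, hasMFDerivAt_derivAlong hf hW, ?_⟩
  rw [derivAlong, mlieBracket_eq_lieBracket_chartField,
    mfderiv_eq_fderiv_extChartAt (hf.mdifferentiableAt two_ne_zero)]
  refine (fderiv_apply_lieBracket hf2 (n := 2) (by simp) (differentiableAt_chartField hW)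
    (differentiableAt_chartField hV)).trans ?_
  rw [chartField_self, chartField_self]
  rfl

end DirectionalDerivative

/-- No regularity of `φ` is needed: comparing with one pair on which `b` is nonzero eliminates it by
cross-multiplication. If there is no such pair, `c = 0` works. -/
theorem exists_apply_deriv_eq_of_apply_eq_mul {ι F : Type*} [NormedAddCommGroup F]
    [NormedSpace ℝ F] (b : F →L[ℝ] F →L[ℝ] ℝ) {G : ι → ℝ → F} {G₀ G' : ι → F} {φ : ℝ → ℝ}
    (h₀ : ∀ i, G i 0 = G₀ i) (hG : ∀ i, HasDerivAt (G i) (G' i) 0)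
    (hφ : ∀ i j t, b (G i t) (G j t) = φ t * b (G₀ i) (G₀ j)) :
    ∃ c : ℝ, ∀ i j, b (G' i) (G₀ j) + b (G₀ i) (G' j) = c * b (G₀ i) (G₀ j) := by
  obtain rfl : (fun i => G i 0) = G₀ := funext h₀
  have hd : ∀ i j, HasDerivAt (fun t => b (G i t) (G j t))
      (b (G' i) (G j 0) + b (G i 0) (G' j)) 0 := fun i j =>
    (b.hasFDerivAt.comp_hasDerivAt 0 (hG i)).clm_apply (hG j)
  by_cases h0 : ∃ i j, b (G i 0) (G j 0) ≠ 0
  · obtain ⟨i₀, j₀, h0⟩ := h0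
    refine ⟨(b (G' i₀) (G j₀ 0) + b (G i₀ 0) (G' j₀)) / b (G i₀ 0) (G j₀ 0), fun i j => ?_⟩
    have h1 := (hd i j).mul_const (b (G i₀ 0) (G j₀ 0))
    have h2 := (hd i₀ j₀).mul_const (b (G i 0) (G j 0))
    have h3 : (fun t => b (G i t) (G j t) * b (G i₀ 0) (G j₀ 0)) =
        fun t => b (G i₀ t) (G j₀ t) * b (G i 0) (G j 0) := by
      funext t
      rw [hφ i j t, hφ i₀ j₀ t]
      ring
    rw [h3] at h1
    have := h1.unique h2
    field_simp
    linarith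
  · push Not at h0
    refine ⟨0, fun i j => ?_⟩
    have h1 := hd i j
    have h3 : (fun t => b (G i t) (G j t)) = fun _ => 0 := by
      funext t
      rw [hφ i j t, h0, mul_zero]
    rw [h3] at h1
    rw [h1.unique (hasDerivAt_const 0 (0 : ℝ)), zero_mul]

/-! ### The isotropy representation is infinitesimally conformal. -/

section Orbit

open VectorField
open scoped Topology

variable {p q : ℕ} {EK : Type*} [NormedAddCommGroup EK] [NormedSpace ℝ EK]
  {K : Type*} [TopologicalSpace K] [ChartedSpace EK K] [Group K]
  {M : Type*} [TopologicalSpace M] [ChartedSpace (EuclideanSpace ℝ (Fin (p + q))) M]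
  [MulAction K M]

theorem contMDiff_smul_right_of_contMDiff [IsManifold 𝓘(ℝ, EK) ∞ K]
    (hs : ContMDiff (𝓘(ℝ, EK).prod (𝓡 (p + q)))
      (𝓡 (p + q)) ∞ (fun x : K × M => x.1 • x.2)) (o : M) :
    ContMDiff 𝓘(ℝ, EK) (𝓡 (p + q)) ∞ (fun k : K => k • o) :=
  hs.comp (contMDiff_id.prodMk contMDiff_const)

theorem contMDiff_smul_left_of_contMDiff
    (hs : ContMDiff (𝓘(ℝ, EK).prod (𝓡 (p + q)))
      (𝓡 (p + q)) ∞ (fun x : K × M => x.1 • x.2)) (k : K) :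
    ContMDiff (𝓡 (p + q)) (𝓡 (p + q)) ∞
      (fun x : M => k • x) :=
  hs.comp (contMDiff_const.prodMk contMDiff_id)

/-- The orbit map of `o`, read in the preferred chart at `o`. -/
noncomputable def orbitChart (K : Type*) [Group K] [MulAction K M] (o : M) (k : K) :
    EuclideanSpace ℝ (Fin (p + q)) :=
  extChartAt (𝓡 (p + q)) o (k • o)

theorem mulInvariantVectorField_one (Y : GroupLieAlgebra 𝓘(ℝ, EK) K) :
    mulInvariantVectorField Y 1 = Y := by
  have h : (fun x : K => 1 * x) = id := funext one_mul
  rw [mulInvariantVectorField, h, mfderiv_id]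
  rfl

variable [LieGroup 𝓘(ℝ, EK) ∞ K]

theorem orbitDiff_eq_zero_of_curve
    (hs : ContMDiff (𝓘(ℝ, EK).prod (𝓡 (p + q)))
      (𝓡 (p + q)) ∞ (fun x : K × M => x.1 • x.2)) (o : M)
    {γ : ℝ → K} (h0 : γ 0 = 1) (hγ : ∀ t, γ t • o = o)
    (hd : MDifferentiableAt 𝓘(ℝ) 𝓘(ℝ, EK) γ 0) {h : GroupLieAlgebra 𝓘(ℝ, EK) K}
    (hh : mfderiv 𝓘(ℝ) 𝓘(ℝ, EK) γ 0 (1 : ℝ) = h) :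
    orbitDiff (p := p) (q := q) (K := K) o h = 0 := by
  subst hh
  have hπ := (contMDiff_smul_right_of_contMDiff hs o).mdifferentiable (by simp)
  have h1 := mfderiv_comp_apply_of_eq (x := (0 : ℝ)) (hπ 1) hd h0 (1 : ℝ)
  have h2 : (fun k : K => k • o) ∘ γ = fun _ => o := funext hγ
  rw [h2, mfderiv_const] at h1
  exact h1.symm

theorem contMDiffAt_orbitChart
    (hs : ContMDiff (𝓘(ℝ, EK).prod (𝓡 (p + q)))
      (𝓡 (p + q)) ∞ (fun x : K × M => x.1 • x.2)) (o : M) :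
    ContMDiffAt 𝓘(ℝ, EK) (𝓡 (p + q)) ∞
      (orbitChart (p := p) (q := q) K o) 1 := by
  refine ContMDiffAt.comp (1 : K) ?_ (contMDiff_smul_right_of_contMDiff hs o).contMDiffAt
  rw [one_smul]
  exact contMDiffAt_extChartAt

variable [IsManifold (𝓡 (p + q)) ∞ M]

theorem mfderiv_orbitChart_one
    (hs : ContMDiff (𝓘(ℝ, EK).prod (𝓡 (p + q)))
      (𝓡 (p + q)) ∞ (fun x : K × M => x.1 • x.2)) (o : M)
    (Y : GroupLieAlgebra 𝓘(ℝ, EK) K) :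
    mfderiv 𝓘(ℝ, EK) (𝓡 (p + q)) (orbitChart (p := p) (q := q) K o) 1 Y =
      orbitDiff (p := p) (q := q) o Y := by
  have h1 := (contMDiff_smul_right_of_contMDiff hs o).mdifferentiable (by simp) 1
  have h2 := mdifferentiableAt_extChartAt (I := 𝓡 (p + q))
    (mem_chart_source (EuclideanSpace ℝ (Fin (p + q))) o)
  refine (mfderiv_comp_apply_of_eq (x := (1 : K)) h2 h1 (one_smul K o) Y).trans ?_
  rw [one_smul, mfderiv_extChartAt_self]
  rfl

/-- Left translation in the group corresponds to the action on the orbit. -/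
theorem derivAlong_orbitChart_mulInvariantVectorField
    (hs : ContMDiff (𝓘(ℝ, EK).prod (𝓡 (p + q)))
      (𝓡 (p + q)) ∞ (fun x : K × M => x.1 • x.2)) (o : M)
    (Y : GroupLieAlgebra 𝓘(ℝ, EK) K) {k : K}
    (hk : k • o ∈ (chartAt (EuclideanSpace ℝ (Fin (p + q))) o).source) :
    derivAlong (orbitChart (p := p) (q := q) K o) (mulInvariantVectorField Y) k =
      mfderiv (𝓡 (p + q)) (𝓡 (p + q))
        (extChartAt (𝓡 (p + q)) o) (k • o)
        (mfderiv (𝓡 (p + q)) (𝓡 (p + q))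
          (fun x : M => k • x) o (orbitDiff (p := p) (q := q) o Y)) := by
  have hψ := (mdifferentiableAt_extChartAt (I := (𝓡 (p + q))) hk)
  have hπ := (contMDiff_smul_right_of_contMDiff hs o).mdifferentiable (by simp)
  have hc := (contMDiff_smul_left_of_contMDiff hs k).mdifferentiable (by simp)
  have hl : MDifferentiableAt 𝓘(ℝ, EK) 𝓘(ℝ, EK) (fun x : K => k * x) 1 :=
    (contMDiff_mul_left (I := 𝓘(ℝ, EK)) (n := ∞) (a := k)).mdifferentiable (by simp) 1
  have hf : MDifferentiableAt 𝓘(ℝ, EK) (𝓡 (p + q)) (orbitChart (p := p) (q := q) K o) k :=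
    hψ.comp k (hπ k)
  have h1 := mfderiv_comp_apply_of_eq (x := (1 : K)) hf hl (mul_one k) Y
  have h2 := mfderiv_comp_apply_of_eq (x := (1 : K)) (hψ.comp o (hc o)) (hπ 1) (one_smul K o) Y
  have h3 := mfderiv_comp_apply (x := o) hψ (hc o) (orbitDiff (p := p) (q := q) o Y)
  have h4 : orbitChart (p := p) (q := q) K o ∘ (fun x : K => k * x) =
      (extChartAt (𝓡 (p + q)) o ∘ fun x : M => k • x) ∘ fun x : K => x • o := by
    funext x
    exact congrArg (extChartAt (𝓡 (p + q)) o) (mul_smul k x o)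
  have h5 : mfderiv 𝓘(ℝ, EK) (𝓡 (p + q)) (orbitChart (p := p) (q := q) K o ∘
      (fun x : K => k * x)) 1 Y = mfderiv 𝓘(ℝ, EK) (𝓡 (p + q))
        ((extChartAt (𝓡 (p + q)) o ∘ fun x : M => k • x) ∘ fun x : K => x • o) 1 Y := by
    rw [h4]
  refine Eq.trans ?_ (h1.symm.trans (h5.trans (h2.trans ?_)))
  · rfl
  · rw [one_smul]
    exact h3

variable [CompleteSpace EK]

/-- The differential of the orbit map on a bracket with an element of the isotropy algebra is the
derivative of the isotropy representation. -/
theorem exists_hasDerivAt_isotropy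
    (hs : ContMDiff (𝓘(ℝ, EK).prod (𝓡 (p + q)))
      (𝓡 (p + q)) ∞ (fun x : K × M => x.1 • x.2)) (o : M)
    {γ : ℝ → K} (h0 : γ 0 = 1) (hγ : ∀ t, γ t • o = o)
    (hd : MDifferentiableAt 𝓘(ℝ) 𝓘(ℝ, EK) γ 0) {h : GroupLieAlgebra 𝓘(ℝ, EK) K}
    (hh : mfderiv 𝓘(ℝ) 𝓘(ℝ, EK) γ 0 (1 : ℝ) = h) (Y : GroupLieAlgebra 𝓘(ℝ, EK) K) :
    HasDerivAt (F := EuclideanSpace ℝ (Fin (p + q)))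
      (fun t => mfderiv (𝓡 (p + q)) (𝓡 (p + q)) (fun x : M => γ t • x) o
          (orbitDiff (p := p) (q := q) o Y))
      (orbitDiff (p := p) (q := q) o ⁅h, Y⁆) 0 := by
  have : LieGroup 𝓘(ℝ, EK) (minSmoothness ℝ 3) K :=
    LieGroup.of_le (n := ∞) (by simpa using ENat.LEInfty.out)
  have : IsManifold 𝓘(ℝ, EK) 2 K := IsManifold.of_le (n := ∞) ENat.LEInfty.out
  have hh0 : orbitDiff (p := p) (q := q) o h = 0 := orbitDiff_eq_zero_of_curve hs o h0 hγ hd hh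
  obtain ⟨A, B, hA, hB, hAB⟩ := exists_hasMFDerivAt_derivAlong
    ((contMDiffAt_orbitChart hs o).of_le ENat.LEInfty.out)
    (mdifferentiableAt_mulInvariantVectorField h) (mdifferentiableAt_mulInvariantVectorField Y)
  -- By equivariance the orbit map kills the left-invariant field of `h` at every point near `1`, as
  -- it does at `1`. Of the commutator only the derivative along `h` of the `Y`-derivative remains.
  have hA0 : A = 0 := by
    refine hasMFDerivAt_unique hA ((hasMFDerivAt_const (0 : EuclideanSpace ℝ (Fin (p + q)))
      1).congr_of_eventuallyEq ?_)
    have hc : ContinuousAt (fun k : K => k • o) 1 :=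
      (contMDiff_smul_right_of_contMDiff hs o).continuous.continuousAt
    have hn : (chartAt (EuclideanSpace ℝ (Fin (p + q))) o).source ∈ 𝓝 ((1 : K) • o) := by
      rw [one_smul]
      exact chart_source_mem_nhds _ o
    filter_upwards [hc.preimage_mem_nhds hn] with k hk
    rw [derivAlong_orbitChart_mulInvariantVectorField hs o h hk, hh0, map_zero, map_zero]
    rfl
  have h1 : derivAlong (orbitChart (p := p) (q := q) K o) (mlieBracket 𝓘(ℝ, EK)
      (mulInvariantVectorField h) (mulInvariantVectorField Y)) 1 =
      orbitDiff (p := p) (q := q) o ⁅h, Y⁆ := mfderiv_orbitChart_one hs o _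
  rw [← h1, hAB, hA0, mulInvariantVectorField_one]
  have h2 : HasMFDerivAt 𝓘(ℝ) 𝓘(ℝ, EK) γ 0 (mfderiv 𝓘(ℝ) 𝓘(ℝ, EK) γ 0) := hd.hasMFDerivAt
  rw [← h0] at hB
  have h3 : HasFDerivAt (derivAlong (orbitChart (p := p) (q := q) K o)
      (mulInvariantVectorField Y) ∘ γ) (B ∘L (mfderiv 𝓘(ℝ) 𝓘(ℝ, EK) γ 0 : ℝ →L[ℝ] EK)) 0 :=
    hasMFDerivAt_iff_hasFDerivAt.1 (hB.comp (0 : ℝ) h2)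
  have h4 := h3.hasDerivAt
  have h5 : derivAlong (orbitChart (p := p) (q := q) K o) (mulInvariantVectorField Y) ∘ γ =
      fun t => mfderiv (𝓡 (p + q)) (𝓡 (p + q)) (fun x : M => γ t • x) o
          (orbitDiff (p := p) (q := q) o Y) := by
    funext t
    have ht : γ t • o ∈ (chartAt (EuclideanSpace ℝ (Fin (p + q))) o).source := by
      rw [hγ]
      exact mem_chart_source _ o
    rw [Function.comp_apply, derivAlong_orbitChart_mulInvariantVectorField hs o Y ht, hγ,
      mfderiv_extChartAt_self]
    rfl
  rw [h5] at h4
  refine h4.congr_deriv ?_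
  rw [← hh]
  exact (sub_zero (B _)).symm

/-- Elements of the isotropy algebra act on the tangent space by infinitesimal conformal maps. -/
theorem exists_inner_orbitDiff_lie {g : PseudoRiemannianMetric p q M}
    (hg : IsHomogeneousConformal EK K g) (o : M) {h : GroupLieAlgebra 𝓘(ℝ, EK) K}
    (hh : h ∈ subgroupLieAlgebra (MulAction.stabilizer K o)) :
    ∃ c : ℝ, ∀ Y Z : GroupLieAlgebra 𝓘(ℝ, EK) K,
      g.inner o (orbitDiff o ⁅h, Y⁆) (orbitDiff o Z) +
        g.inner o (orbitDiff o Y) (orbitDiff o ⁅h, Z⁆) =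
      c * g.inner o (orbitDiff o Y) (orbitDiff o Z) := by
  have hs := hg.smooth_action
  have : LieGroup 𝓘(ℝ, EK) (minSmoothness ℝ 3) K :=
    LieGroup.of_le (n := ∞) (by simpa using ENat.LEInfty.out)
  have hD : ∀ X Y : GroupLieAlgebra 𝓘(ℝ, EK) K, orbitDiff (p := p) (q := q) o (X + Y) =
      orbitDiff (p := p) (q := q) o X + orbitDiff (p := p) (q := q) o Y := fun X Y => map_add _ X Y
  have hDs : ∀ (r : ℝ) (X : GroupLieAlgebra 𝓘(ℝ, EK) K), orbitDiff (p := p) (q := q) o (r • X) =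
      r • orbitDiff (p := p) (q := q) o X := fun r X => map_smul _ r X
  induction hh using Submodule.span_induction with
  | mem h hh =>
    obtain ⟨γ, h0, hγ, hd, hh⟩ := hh
    choose g' hg' hgi using hg.conformal
    choose f _ _ hf using hg'
    have hx : ∀ x y : M, x = y → ∀ v w : EuclideanSpace ℝ (Fin (p + q)),
        g.inner x v w = g.inner y v w := by
      rintro x y rfl v w
      rfl
    have h1 : ∀ v : EuclideanSpace ℝ (Fin (p + q)),
        mfderiv (𝓡 (p + q)) (𝓡 (p + q)) (fun x : M => γ 0 • x) o v = v := fun v => by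
      have : (fun x : M => γ 0 • x) = id := by
        funext x
        rw [h0, one_smul, id]
      rw [this, mfderiv_id]
      rfl
    -- The maps `γ t` fix `o`, so their differentials there rescale the single form `g.inner o`.
    exact exists_apply_deriv_eq_of_apply_eq_mul
      (F := EuclideanSpace ℝ (Fin (p + q))) (g.inner o) (φ := fun t => f (γ t) o) (fun Y => h1 _)
      (exists_hasDerivAt_isotropy hs o h0 hγ hd hh) fun Y Z t =>
        (hx _ _ (hγ t).symm _ _).trans ((hgi (γ t) o _ _).symm.trans (hf _ _ _ _))
  | zero =>
    refine ⟨0, fun Y Z => ?_⟩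
    rw [zero_lie, zero_lie, show orbitDiff (p := p) (q := q) o
      (0 : GroupLieAlgebra 𝓘(ℝ, EK) K) = 0 from map_zero _]
    simp
  | add h h' _ _ ih ih' =>
    obtain ⟨c, hc⟩ := ih
    obtain ⟨c', hc'⟩ := ih'
    refine ⟨c + c', fun Y Z => ?_⟩
    rw [add_lie, add_lie, hD, hD, map_add, map_add, _root_.add_apply]
    linear_combination hc Y Z + hc' Y Z
  | smul r h _ ih =>
    obtain ⟨c, hc⟩ := ih
    refine ⟨r * c, fun Y Z => ?_⟩
    rw [smul_lie, smul_lie, hDs, hDs, map_smul, map_smul, _root_.smul_apply,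
      smul_eq_mul, smul_eq_mul]
    linear_combination r * hc Y Z

end Orbit

/-! ### The geometric statement. -/

theorem proposition2p1 (p q : ℕ) (hpq : p ≤ q)
    {EK : Type*} [NormedAddCommGroup EK] [NormedSpace ℝ EK] [FiniteDimensional ℝ EK]
    {K : Type*} [TopologicalSpace K] [ChartedSpace EK K] [Group K] [LieGroup 𝓘(ℝ, EK) ∞ K]
    {M : Type*} [TopologicalSpace M] [ChartedSpace (EuclideanSpace ℝ (Fin (p + q))) M]
    [IsManifold 𝓘(ℝ, EuclideanSpace ℝ (Fin (p + q))) ∞ M] [MulAction K M]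
    (g : PseudoRiemannianMetric p q M) (hg : IsHomogeneousConformal EK K g) (o : M)
    (𝔥 : Submodule ℝ (GroupLieAlgebra 𝓘(ℝ, EK) K))
    (h𝔥 : 𝔥 = subgroupLieAlgebra (MulAction.stabilizer K o))
    (αm : (GroupLieAlgebra 𝓘(ℝ, EK) K ⧸ 𝔥) ≃ₗ[ℝ] (MidIdx p q → ℝ))
    (hαm : ∃ g' ∈ conformalClass g, ∀ Y₁ Y₂ : GroupLieAlgebra 𝓘(ℝ, EK) K,
      nuForm p q (αm (𝔥.mkQ Y₁)) (αm (𝔥.mkQ Y₂)) =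
        g'.inner o (orbitDiff o Y₁) (orbitDiff o Y₂)) :
    ∃ α : GroupLieAlgebra 𝓘(ℝ, EK) K →ₗ[ℝ] soAlg p q,
      (∀ Y₁ : GroupLieAlgebra 𝓘(ℝ, EK) K, ∀ Yh ∈ 𝔥, ⁅α Y₁, α Yh⁆ - α ⁅Y₁, Yh⁆ = 0) ∧
      (∃ hα : 𝔥 ≤ (parabolic p q).comap α,
        LinearMap.range (𝔥.mapQ (parabolic p q) α hα) = ⊤) ∧
      (∀ Y, vectorPart p q (α Y) = αm (𝔥.mkQ Y)) ∧
      ∃ κ : (soAlg p q ⧸ parabolic p q) [⋀^Fin 2]→ₗ[ℝ] soAlg p q,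
        (∀ Y₁ Y₂ : GroupLieAlgebra 𝓘(ℝ, EK) K,
          κ ![(parabolic p q).mkQ (α Y₁), (parabolic p q).mkQ (α Y₂)] =
            ⁅α Y₁, α Y₂⁆ - α ⁅Y₁, Y₂⁆) ∧
        ∀ (b : Module.Basis (MidIdx p q) ℝ (MidIdx p q → ℝ))
          (X : MidIdx p q → GroupLieAlgebra 𝓘(ℝ, EK) K), (∀ i, αm (𝔥.mkQ (X i)) = b i) →
          ∀ Y, ∑ i, ⁅dualEmb p q (b.coord i),
            κ ![(parabolic p q).mkQ (α Y), (parabolic p q).mkQ (α (X i))]⁆ = 0 := by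
  have : LieGroup 𝓘(ℝ, EK) (minSmoothness ℝ 3) K :=
    LieGroup.of_le (n := ∞) (by simpa using ENat.LEInfty.out)
  have : CompleteSpace EK := FiniteDimensional.complete ℝ EK
  have : FiniteDimensional ℝ (GroupLieAlgebra 𝓘(ℝ, EK) K) := ‹FiniteDimensional ℝ EK›
  obtain ⟨g', ⟨f, -, -, hf⟩, hν⟩ := hαm
  have hθ0 : ∀ h, (αm.toLinearMap ∘ₗ 𝔥.mkQ) h = 0 ↔ h ∈ 𝔥 := fun h => by
    rw [LinearMap.comp_apply, LinearEquiv.coe_coe, LinearEquiv.map_eq_zero_iff,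
      Submodule.mkQ_apply, Submodule.Quotient.mk_eq_zero]
  have hθ : Function.Surjective (αm.toLinearMap ∘ₗ 𝔥.mkQ) :=
    αm.surjective.comp 𝔥.mkQ_surjective
  have hiso : ∀ h, (αm.toLinearMap ∘ₗ 𝔥.mkQ) h = 0 → ∃ c : ℝ, ∀ Y Z,
      nuBil p q ((αm.toLinearMap ∘ₗ 𝔥.mkQ) ⁅h, Y⁆) ((αm.toLinearMap ∘ₗ 𝔥.mkQ) Z) +
        nuBil p q ((αm.toLinearMap ∘ₗ 𝔥.mkQ) Y) ((αm.toLinearMap ∘ₗ 𝔥.mkQ) ⁅h, Z⁆) =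
      c * nuBil p q ((αm.toLinearMap ∘ₗ 𝔥.mkQ) Y) ((αm.toLinearMap ∘ₗ 𝔥.mkQ) Z) := fun h hh => by
    -- Replacing `g` by `g'` multiplies the form at `o` by the constant `f o`, so the same
    -- infinitesimal factor `c` serves for `ν`.
    rw [hθ0, h𝔥] at hh
    obtain ⟨c, hc⟩ := exists_inner_orbitDiff_lie hg o hh
    have hb : ∀ Y Z, nuBil p q ((αm.toLinearMap ∘ₗ 𝔥.mkQ) Y) ((αm.toLinearMap ∘ₗ 𝔥.mkQ) Z) =
        f o * g.inner o (orbitDiff o Y) (orbitDiff o Z) := fun Y Z =>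
      (nuBil_apply p q _ _).trans ((hν Y Z).trans (hf _ _ _))
    refine ⟨c, fun Y Z => ?_⟩
    rw [hb, hb, hb]
    linear_combination f o * hc Y Z
  obtain ⟨α, h1, h2, κ, h3, h4⟩ := hasNormalConnection_of_isotropy hpq hθ hiso
  have h5 : 𝔥 ≤ (parabolic p q).comap α := fun h hh => by
    rw [Submodule.mem_comap, parabolic, LinearMap.mem_ker, h2]
    exact (hθ0 h).2 hh
  refine ⟨α, fun Y₁ Yh hY => h1 Y₁ Yh ((hθ0 Yh).2 hY), ⟨h5, ?_⟩, h2, κ, h3, h4⟩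
  rw [LinearMap.range_eq_top]
  intro x
  obtain ⟨A, rfl⟩ := (parabolic p q).mkQ_surjective x
  obtain ⟨Y, hY⟩ := hθ (vectorPart p q A)
  refine ⟨𝔥.mkQ Y, ?_⟩
  rw [Submodule.mkQ_apply, Submodule.mapQ_apply, Submodule.mkQ_apply, Submodule.Quotient.eq,
    parabolic, LinearMap.mem_ker, map_sub, h2, hY, sub_self]
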